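/- **Theorem 1.5.** Let $S$ be a nonempty countable set, let $\{0,1\}^S$ carry the product topology, its Borel $\sigma$-algebra and the coordinatewise order, and for $p\in[0,1]$ let $\pi_p$ be the law on $\{0,1\}^S$ of independent coordinates each equal to $1$ with probability $p$ and $0$ otherwise. For probability measures $\mu,\mu'$ on $\{0,1\}^S$ write $\mu\preceq\mu'$ if $\int f\,d\mu\le\int f\,d\mu'$ for every continuous increasing $f:\{0,1\}^S\to\mathbb R$. For $\epsilon\in(0,1)$ let $\mu^{(+,\epsilon)}$ (respectively $\mu^{(-,\epsilon)}$) be the law of the configuration obtained by choosing an element of $\{0,1\}^S$ according to $\mu$ and then independently changing each $0$ to a $1$ (respectively each $1$ to a $0$) with probability $\epsilon$. Put $p_{\max,\mu}=\sup\{p\in[0,1]:\pi_p\preceq\mu\}$; the supremum is attained. Consider the following properties of a probability measure $\mu$ on $\{0,1\}^S$: - (I) $\mu$ is uniformly upwards extractable: there are $\epsilon\in(0,1)$ and a probability measure $\nu$ on $\{0,1\}^S$ with $\mu=\nu^{(+,\epsilon)}$. - (II) $\mu$ is uniformly insertion tolerant: there is $\epsilon>0$ such that for every $s\in S$, $\mu\bigl(\sigma(s)=1\mid\sigma(S\setminus\{s\})\bigr)\ge\epsilon$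 $\mu$-almost surely. - (III) $\mu$ is rigid: there is no $\epsilon\in(0,1)$ with $\pi_{p_{\max,\mu}}\preceq\mu^{(-,\epsilon)}$. - (IV) There is a $p>0$ such that $\pi_p\preceq\mu$. Then, for every such $S$ and $\mu$, (I) $\Rightarrow$ (II) $\Rightarrow$ (IV) and (I) $\Rightarrow$ (III) $\Rightarrow$ (IV). None of the four reverse implications (II) $\Rightarrow$ (I), (IV) $\Rightarrow$ (II), (III) $\Rightarrow$ (I), (IV) $\Rightarrow$ (III) holds in general, and (III) does not imply (II) in general. Moreover, for each of these five nonimplications there is a translation invariant probability measure on $\{0,1\}^{\mathbb Z}$ that satisfies the premise but not the conclusion. -/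

import Mathlib

open MeasureTheory
open scoped ProbabilityTheory

namespace Domination

variable {S : Type*}

/-- The product measure `π_p` on `{0,1}^S`: the coordinates are independent, each equal to `1`
(`true`) with probability `p` and to `0` (`false`) with probability `1 - p`. -/
noncomputable def prodBer (S : Type*) (p : unitInterval) : Measure (S → Bool) :=
  Measure.infinitePi fun _ : S => ProbabilityTheory.bernoulliMeasure true false p

/-- `μ^{(+,ε)}`: choose a configuration `σ` according to `μ`, and then independently change each
`0` to a `1` with probability `ε`. The independent configuration `η ∼ π_ε` marks the sites at
which a `0` is to be changed. -/
noncomputable def plusNoise (μ : Measure (S → Bool)) (ε : unitInterval) : Measure (S → Bool) :=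
  (μ.prod (prodBer S ε)).map fun x s => x.1 s || x.2 s

/-- `μ^{(-,ε)}`: choose a configuration `σ` according to `μ`, and then independently change each
`1` to a `0` with probability `ε`. The independent configuration `η ∼ π_ε` marks the sites at
which a `1` is to be changed. -/
noncomputable def minusNoise (μ : Measure (S → Bool)) (ε : unitInterval) : Measure (S → Bool) :=
  (μ.prod (prodBer S ε)).map fun x s => x.1 s && !x.2 s

/-- Stochastic domination `μ ⪯ μ'`: `∫ f dμ ≤ ∫ f dμ'` for every continuous increasing
`f : {0,1}^S → ℝ` (product topology and coordinatewise order). -/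
def StochDom (μ μ' : Measure (S → Bool)) : Prop :=
  ∀ f : (S → Bool) → ℝ, Continuous f → Monotone f → ∫ σ, f σ ∂μ ≤ ∫ σ, f σ ∂μ'

/-- The pair `(μ₁, μ₂)` is downwards movable: `μ₁ ⪯ μ₂` and `μ₁ ⪯ μ₂^{(-,ε)}` for some
`ε ∈ (0,1)`. -/
def DownwardsMovable (μ₁ μ₂ : Measure (S → Bool)) : Prop :=
  StochDom μ₁ μ₂ ∧ ∃ ε : unitInterval, 0 < ε ∧ ε < 1 ∧ StochDom μ₁ (minusNoise μ₂ ε)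

/-- `p_{max,μ} = sup {p ∈ [0,1] : π_p ⪯ μ}`, the supremum being taken in `[0,1]`. -/
noncomputable def pMax (μ : Measure (S → Bool)) : unitInterval :=
  sSup {p : unitInterval | StochDom (prodBer S p) μ}

/-- `μ` is rigid if the pair `(π_{p_{max,μ}}, μ)` is not downwards movable. -/
def Rigid (μ : Measure (S → Bool)) : Prop :=
  ¬ DownwardsMovable (prodBer S (pMax μ)) μ

/-- `ε`-insertion tolerance: for every site `s`, the conditional probability that `σ(s) = 1`
given the configuration on `S \ {s}` is at least `ε` almost surely. -/
def InsertionTolerant (μ : Measure (S → Bool)) (ε : ℝ) : Prop :=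
  ∀ s : S, ∀ᵐ σ ∂μ,
    ε ≤ (μ⟦{τ : S → Bool | τ s = true} | cylinderEvents ({s}ᶜ : Set S)⟧) σ

/-- `μ` is uniformly insertion tolerant. -/
def UniformlyInsertionTolerant (μ : Measure (S → Bool)) : Prop :=
  ∃ ε : ℝ, 0 < ε ∧ InsertionTolerant μ ε

/-- `μ` is `ε`-upwards extractable: `μ = ν^{(+,ε)}` for some probability measure `ν`. -/
def UpwardsExtractable (μ : Measure (S → Bool)) (ε : unitInterval) : Prop :=
  ∃ ν : Measure (S → Bool), IsProbabilityMeasure ν ∧ μ = plusNoise ν ε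

/-- `μ` is uniformly upwards extractable: it is `ε`-upwards extractable for some
`ε ∈ (0,1)`. -/
def UniformlyUpwardsExtractable (μ : Measure (S → Bool)) : Prop :=
  ∃ ε : unitInterval, 0 < ε ∧ ε < 1 ∧ UpwardsExtractable μ ε

/-- `μ` stochastically dominates `π_p` for some `p ∈ (0,1]`. -/
def DominatesProduct (μ : Measure (S → Bool)) : Prop :=
  ∃ p : unitInterval, 0 < p ∧ StochDom (prodBer S p) μ

/-- Translation invariance of a measure on `{0,1}^ℤ`. -/
def TranslationInvariant (μ : Measure (ℤ → Bool)) : Prop :=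
  ∀ k : ℤ, μ.map (fun (σ : ℤ → Bool) (i : ℤ) => σ (i + k)) = μ

end Domination

/-!
Insertion tolerance bounds the conditional probability of a `1` at a site from below, so resampling
the sites one after the other from `π_ε` decreases the measure; once every site has been resampled,
this gives `π_ε ⪯ μ`. If `μ = ν^{(+,ε)}` and `π_m ⪯ μ^{(-,δ)}` for `m = p_{max,μ}`, then
`π_m ⪯ ν^{(+,ε')}` for some `ε' < ε`, and adding to both sides the plus noise that turns `ε'` back
into `ε` shows that `μ` dominates a product measure with a parameter larger than `m`.

Three measures on `{0,1}^ℤ` separate the properties.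

* The maxima `u i ∨ u (i + 1)` of fair bits are not insertion tolerant, because a site between two
  `0`s is a `0`. They dominate `π_{1/2}`, but after removing `1`s with probability `ε` an interval
  of length `L` is vacant with probability at least `c r ^ L` for some `r > 1 / 2`, so they are
  rigid.
* Let blocks of length `n` be occupied as a whole, a block being vacant with half its probability
  `v = (1 - p²) ^ n` under `π_{p²}`. Keeping each `1` with probability `p` leaves a measure above
  `π_{p²}`: on a block, an increasing event `A` which fails when the block is vacant satisfies
  `π_{p²}(A) ≤ min (π_p(A)²) (1 - v) ≤ (1 - v / 2) π_p(A)`. The factor `1 / 2` disappears in the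
  exponential rate as `n → ∞`, so mixing over `n` gives `p_max ≤ p²` and rigidity fails.
* Let each block of length `n` consist of fair bits, up to a bias of its parity. Flipping a site
  changes this law by a bounded factor, which gives insertion tolerance. All the expectations of
  products of spins are nonnegative, and under `ν^{(+,ε)}` this forces the expectation of a product
  over `n` sites to be at most `(1 - ε) ^ n`; the mixture over `n` has one of order `n⁻²`.

In both mixtures the length is dyadic with polynomial weights, and a uniform phase of the blocks
makes the law translation invariant.
-/

namespace Domination

open ProbabilityTheory Filter Topology
open scoped ENNReal NNReal unitInterval

section ProductMeasures

section Associativity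

variable {α β γ δ η : Type*} [MeasurableSpace α] [MeasurableSpace β] [MeasurableSpace γ]
  [MeasurableSpace δ] [MeasurableSpace η] (μ : Measure α) (ν : Measure β) (ρ : Measure γ)
  [SFinite μ] [SFinite ν] [SFinite ρ]

lemma map_prod_map_left {f : α × β → δ} (hf : Measurable f) {g : δ × γ → η}
    (hg : Measurable g) :
    (((μ.prod ν).map f).prod ρ).map g =
      (μ.prod (ν.prod ρ)).map fun z => g (f (z.1, z.2.1), z.2.2) := by
  nth_rw 1 [← Measure.map_id (μ := ρ)]
  rw [Measure.map_prod_map _ _ hf measurable_id, Measure.map_map hg (hf.prodMap measurable_id),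
    ← Measure.prodAssoc_prod, Measure.map_map (by fun_prop) (by fun_prop)]
  rfl

lemma map_prod_map_right {f : β × γ → δ} (hf : Measurable f) {g : α × δ → η}
    (hg : Measurable g) :
    (μ.prod ((ν.prod ρ).map f)).map g =
      (μ.prod (ν.prod ρ)).map fun z => g (z.1, f z.2) := by
  nth_rw 1 [← Measure.map_id (μ := μ)]
  rw [Measure.map_prod_map _ _ measurable_id hf, Measure.map_map hg (measurable_id.prodMap hf)]
  rfl

lemma prod_prod_prod_comm (τ : Measure δ) [SFinite τ] :
    ((μ.prod ν).prod (ρ.prod τ)).map (fun z => ((z.1.1, z.2.1), (z.1.2, z.2.2))) =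
      (μ.prod ρ).prod (ν.prod τ) := by
  have swap := ((measurePreserving_prodAssoc ρ ν τ).comp
    ((Measure.measurePreserving_swap (μ := ν) (ν := ρ)).prod (.id τ))).comp
      ((measurePreserving_prodAssoc ν ρ τ).symm _)
  exact (((measurePreserving_prodAssoc μ ρ (ν.prod τ)).symm.comp
    ((MeasurePreserving.id μ).prod swap)).comp
      (measurePreserving_prodAssoc μ ν (ρ.prod τ))).map_eq

end Associativity

variable {ι : Type*} {X Y Z : ι → Type*} [∀ i, MeasurableSpace (X i)]
  [∀ i, MeasurableSpace (Y i)] [∀ i, MeasurableSpace (Z i)]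

lemma map_prod_infinitePi (μ : ∀ i, Measure (X i)) (ν : ∀ i, Measure (Y i))
    [∀ i, IsProbabilityMeasure (μ i)] [∀ i, IsProbabilityMeasure (ν i)]
    {φ : ∀ i, X i × Y i → Z i} (hφ : ∀ i, Measurable (φ i)) :
    ((Measure.infinitePi μ).prod (Measure.infinitePi ν)).map (fun z i => φ i (z.1 i, z.2 i)) =
      Measure.infinitePi fun i => ((μ i).prod (ν i)).map (φ i) := by
  have (i : ι) : IsProbabilityMeasure (((μ i).prod (ν i)).map (φ i)) :=
    Measure.isProbabilityMeasure_map (hφ i).aemeasurable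
  refine Measure.eq_infinitePi _ fun s t ht => ?_
  let g (i : ι) (a : X i) : ℝ≥0∞ := ν i (Prod.mk a ⁻¹' (φ i ⁻¹' t i))
  have hg (i : ι) : Measurable (g i) := measurable_measure_prodMk_left (hφ i (ht i))
  have hbox : MeasurableSet ((s : Set ι).pi t) :=
    .pi s.countable_toSet fun i _ => ht i
  have hm : Measurable fun (z : (∀ i, X i) × (∀ i, Y i)) i => φ i (z.1 i, z.2 i) := by
    fun_prop
  have fiber (x : ∀ i, X i) : Measure.infinitePi ν (Prod.mk x ⁻¹'
      ((fun (z : (∀ i, X i) × (∀ i, Y i)) i => φ i (z.1 i, z.2 i)) ⁻¹' (s : Set ι).pi t)) =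
      ∏ i ∈ s, g i (x i) := by
    rw [← Measure.infinitePi_pi (μ := ν) fun i _ => measurable_prodMk_left (hφ i (ht i))]
    rfl
  rw [Measure.map_apply hm hbox, Measure.prod_apply (hm hbox)]
  simp_rw [fiber]
  rw [lintegral_prod_eq_prod_lintegral_of_indepFun s
    (fun i (x : ∀ i, X i) => g i (x i))
    (iIndepFun_infinitePi hg) fun i => (hg i).comp (measurable_pi_apply i)]
  refine Finset.prod_congr rfl fun i _ => ?_
  rw [Measure.map_apply (hφ i) (ht i), Measure.prod_apply (hφ i (ht i)),
    ← Measure.infinitePi_map_eval μ i, lintegral_map (hg i) (measurable_pi_apply i)]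

lemma map_piecewise_infinitePi (μ : ∀ i, Measure (X i)) [∀ i, IsProbabilityMeasure (μ i)]
    (B : Set ι) [DecidablePred (· ∈ B)] :
    ((Measure.infinitePi μ).prod (Measure.infinitePi μ)).map (fun z => B.piecewise z.1 z.2) =
      Measure.infinitePi μ := by
  have h := map_prod_infinitePi μ μ (φ := fun i z => if i ∈ B then z.1 else z.2) fun i => by
    split_ifs <;> fun_prop
  have marginal (i : ι) :
      ((μ i).prod (μ i)).map (fun z => if i ∈ B then z.1 else z.2) = μ i := by
    split_ifs
    · exact Measure.map_fst_prod.trans (by simp)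
    · exact Measure.map_snd_prod.trans (by simp)
  simp_rw [marginal] at h
  exact h

lemma integral_finsetProd_infinitePi (μ : ∀ i, Measure (X i)) [∀ i, IsProbabilityMeasure (μ i)]
    (F : Finset ι) {φ : ∀ i, X i → ℝ} (hφ : ∀ i, Measurable (φ i)) :
    ∫ x, ∏ i ∈ F, φ i (x i) ∂Measure.infinitePi μ = ∏ i ∈ F, ∫ a, φ i a ∂μ i := by
  have h := ((iIndepFun_infinitePi (P := μ) hφ).precomp
    (Subtype.val_injective (p := (· ∈ F)))).integral_fun_prod_eq_prod_integral
      fun i => ((hφ i).comp (measurable_pi_apply _)).aestronglyMeasurable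
  simp_rw [← Finset.prod_coe_sort F, h]
  refine Finset.prod_congr rfl fun i _ => ?_
  rw [← Measure.infinitePi_map_eval μ i,
    integral_map (measurable_pi_apply _).aemeasurable (hφ _).aestronglyMeasurable]

lemma indep_cylinderEvents_infinitePi (μ : ∀ i, Measure (X i)) [∀ i, IsProbabilityMeasure (μ i)]
    {Δ Δ' : Set ι} (h : Disjoint Δ Δ') :
    Indep (cylinderEvents (X := X) Δ) (cylinderEvents Δ') (Measure.infinitePi μ) :=
  indep_iSup_of_disjoint (fun i => (measurable_pi_apply i).comap_le)
    (iIndepFun_infinitePi (P := μ) (X := fun _ => id) fun _ => measurable_id) h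

end ProductMeasures

section BooleanOperations

variable {S Ω : Type*} [MeasurableSpace Ω] {f g : Ω → S → Bool}

lemma measurable_bool_map₂ (φ : Bool → Bool → Bool) (hf : Measurable f) (hg : Measurable g) :
    Measurable fun ω s => φ (f ω s) (g ω s) :=
  measurable_pi_lambda _ fun s => (measurable_of_countable (Function.uncurry φ)).comp
    (((measurable_pi_apply s).comp hf).prodMk ((measurable_pi_apply s).comp hg))

@[fun_prop]
lemma measurable_sup (hf : Measurable f) (hg : Measurable g) : Measurable fun ω => f ω ⊔ g ω :=
  measurable_bool_map₂ (· ⊔ ·) hf hg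

@[fun_prop]
lemma measurable_inf (hf : Measurable f) (hg : Measurable g) : Measurable fun ω => f ω ⊓ g ω :=
  measurable_bool_map₂ (· ⊓ ·) hf hg

@[fun_prop]
lemma measurable_sdiff (hf : Measurable f) (hg : Measurable g) : Measurable fun ω => f ω \ g ω :=
  measurable_bool_map₂ (· \ ·) hf hg

@[fun_prop]
lemma measurable_compl (hf : Measurable f) : Measurable fun ω => (f ω)ᶜ :=
  measurable_bool_map₂ (fun a _ => aᶜ) hf hf

end BooleanOperations

section BernoulliFields

variable {S : Type*}

lemma plusNoise_eq_map (μ : Measure (S → Bool)) (ε : I) :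
    plusNoise μ ε = (μ.prod (prodBer S ε)).map fun z => z.1 ⊔ z.2 :=
  rfl

lemma minusNoise_eq_map (μ : Measure (S → Bool)) (ε : I) :
    minusNoise μ ε = (μ.prod (prodBer S ε)).map fun z => z.1 \ z.2 :=
  rfl

instance isProbabilityMeasure_prodBer (p : I) : IsProbabilityMeasure (prodBer S p) := by
  unfold prodBer
  infer_instance

lemma map_not_bernoulliMeasure (p : I) :
    (bernoulliMeasure true false p).map (!·) = bernoulliMeasure true false (σ p) := by
  rw [map_bernoulliMeasure]
  simp [bernoulliMeasure_def, add_comm]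

lemma map_compl_prodBer (p : I) : (prodBer S p).map (fun x => xᶜ) = prodBer S (σ p) :=
  (Measure.infinitePi_map_pi _ fun _ => measurable_of_countable _).trans
    (congrArg _ (funext fun _ => map_not_bernoulliMeasure p))

lemma map_and_bernoulliMeasure (p q : I) :
    ((bernoulliMeasure true false p).prod (bernoulliMeasure true false q)).map
      (fun z => z.1 && z.2) = bernoulliMeasure true false (p * q) := by
  have hm : Measurable fun z : Bool × Bool => z.1 && z.2 := measurable_of_countable _
  have split : ((bernoulliMeasure true false p).prod (bernoulliMeasure true false q)).map
      (fun z => z.1 && z.2) = unitInterval.toNNReal q • bernoulliMeasure true false p +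
        unitInterval.toNNReal (σ q) • Measure.dirac false := by
    rw [bernoulliMeasure_def true false q, Measure.prod_add, Measure.prod_smul_right,
      Measure.prod_smul_right, Measure.prod_dirac, Measure.prod_dirac, Measure.map_add _ _ hm]
    simp [Measure.map_smul]
  have htrue : unitInterval.toNNReal (p * q) =
      unitInterval.toNNReal q * unitInterval.toNNReal p := NNReal.eq (mul_comm _ _)
  have hfalse : unitInterval.toNNReal (σ (p * q)) =
      unitInterval.toNNReal q * unitInterval.toNNReal (σ p) + unitInterval.toNNReal (σ q) := by
    ext
    simp only [unitInterval.coe_toNNReal, unitInterval.coe_symm_eq, Set.Icc.coe_mul,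
      NNReal.coe_add, NNReal.coe_mul]
    ring
  rw [split, bernoulliMeasure_def, bernoulliMeasure_def, htrue, hfalse]
  module

lemma map_inf_prodBer (p q : I) :
    ((prodBer S p).prod (prodBer S q)).map (fun z => z.1 ⊓ z.2) = prodBer S (p * q) :=
  (map_prod_infinitePi _ _ fun _ => measurable_of_countable _).trans
    (congrArg _ (funext fun _ => map_and_bernoulliMeasure p q))

lemma minusNoise_prodBer (p q : I) : minusNoise (prodBer S p) q = prodBer S (p * σ q) := by
  rw [← map_inf_prodBer, ← map_compl_prodBer q, ← Measure.map_id (μ := prodBer S p),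
    Measure.map_prod_map _ _ measurable_id (by fun_prop), Measure.map_map (by fun_prop)
      (by fun_prop), Measure.map_id]
  rfl

lemma plusNoise_prodBer (p q : I) :
    plusNoise (prodBer S p) q = prodBer S (σ (σ p * σ q)) := by
  rw [plusNoise_eq_map, ← map_compl_prodBer, ← map_inf_prodBer, ← map_compl_prodBer p,
    ← map_compl_prodBer q, Measure.map_prod_map _ _ (by fun_prop) (by fun_prop),
    Measure.map_map (by fun_prop) (by fun_prop), Measure.map_map (by fun_prop) (by fun_prop)]
  congr 1 with z
  simp

lemma integral_bernoulliMeasure_true_false (p : I) (f : Bool → ℝ) :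
    ∫ b, f b ∂bernoulliMeasure true false p = p * f true + (1 - p) * f false := by
  rw [integral_bernoulliMeasure]
  rfl

lemma map_eval_prodBer (p : I) (s : S) :
    (prodBer S p).map (fun x => x s) = bernoulliMeasure true false p :=
  Measure.infinitePi_map_eval _ s

lemma integral_eval_prodBer (p : I) (s : S) (f : Bool → ℝ) :
    ∫ x, f (x s) ∂prodBer S p = p * f true + (1 - p) * f false := by
  rw [← integral_map (measurable_pi_apply s).aemeasurable
      (measurable_of_countable f).aestronglyMeasurable, map_eval_prodBer,
    integral_bernoulliMeasure_true_false]

lemma map_comp_prodBer {T : Type*} (p : I) {e : T → S} (he : Function.Injective e) :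
    (prodBer S p).map (fun x => x ∘ e) = prodBer T p :=
  Measure.map_infinitePi_infinitePi_of_inj he

lemma prodBer_real_forall_eq (p : I) (F : Finset S) (b : Bool) :
    (prodBer S p).real {x | ∀ s ∈ F, x s = b} = (if b then (p : ℝ) else 1 - p) ^ F.card := by
  have hbox : {x : S → Bool | ∀ s ∈ F, x s = b} = (F : Set S).pi fun _ => {b} := by
    ext x
    simp
  have hmarginal : (bernoulliMeasure true false p).real {b} = if b then (p : ℝ) else 1 - p := by
    rw [bernoulliMeasure_real_apply p (MeasurableSet.singleton b)]
    cases b <;> simp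
  rw [hbox, measureReal_def, prodBer, Measure.infinitePi_pi _ fun _ _ => .of_discrete,
    ENNReal.toReal_prod, Finset.prod_const, ← measureReal_def, hmarginal]

/-- The event that every site of `F` is in state `0`. -/
def vacant (F : Finset S) : Set (S → Bool) := {x | ∀ s ∈ F, x s = false}

lemma prodBer_real_vacant (p : I) (F : Finset S) :
    (prodBer S p).real (vacant F) = (1 - p : ℝ) ^ F.card :=
  prodBer_real_forall_eq p F false

lemma vacant_eq_biInter (F : Finset S) :
    vacant F = ⋂ s ∈ F, (fun x : S → Bool => x s) ⁻¹' {false} := by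
  ext x
  simp [vacant]

lemma isClopen_vacant (F : Finset S) : IsClopen (vacant F) := by
  rw [vacant_eq_biInter]
  exact isClopen_biInter_finset fun s _ => (isClopen_discrete _).preimage (continuous_apply s)

lemma isLowerSet_vacant (F : Finset S) : IsLowerSet (vacant F) := fun _ _ hyx hx s hs =>
  le_bot_iff.1 ((hyx s).trans (hx s hs).le)

end BernoulliFields

section StochasticDomination

variable {S : Type*}

lemma StochDom.trans {μ₁ μ₂ μ₃ : Measure (S → Bool)} (h : StochDom μ₁ μ₂)
    (h' : StochDom μ₂ μ₃) : StochDom μ₁ μ₃ :=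
  fun f hf hm => (h f hf hm).trans (h' f hf hm)

lemma monotone_indicator_one_of_isUpperSet {A : Set (S → Bool)} (hA : IsUpperSet A) :
    Monotone (A.indicator (1 : (S → Bool) → ℝ)) := fun x y hxy => by
  by_cases hx : x ∈ A
  · rw [Set.indicator_of_mem hx, Set.indicator_of_mem (hA hxy hx)]
    rfl
  · rw [Set.indicator_of_notMem hx]
    exact Set.indicator_nonneg (fun _ _ => zero_le_one) y

lemma exists_mul_eq_of_le {a b : I} (h : a ≤ b) : ∃ c : I, b * c = a :=
  ⟨⟨a / b, unitInterval.div_mem a.2.1 b.2.1 h⟩, Subtype.ext <| mul_div_cancel_of_imp' fun hb =>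
    le_antisymm (hb ▸ h) a.2.1⟩

variable [Countable S]

lemma integrable_comp_of_continuous {Ω : Type*} [MeasurableSpace Ω] (P : Measure Ω)
    [IsFiniteMeasure P] {f : (S → Bool) → ℝ} (hf : Continuous f) {g : Ω → S → Bool}
    (hg : Measurable g) :
    Integrable (fun ω => f (g ω)) P := by
  obtain ⟨C, hC⟩ := isCompact_univ.exists_bound_of_continuousOn hf.continuousOn
  exact .of_bound (hf.measurable.comp hg).aestronglyMeasurable C
    (.of_forall fun ω => hC _ (Set.mem_univ _))

lemma integral_map_prod (μ ρ : Measure (S → Bool)) [IsFiniteMeasure μ] [IsFiniteMeasure ρ]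
    {T : (S → Bool) × (S → Bool) → S → Bool} (hT : Measurable T) {f : (S → Bool) → ℝ}
    (hf : Continuous f) :
    ∫ x, f x ∂(μ.prod ρ).map T = ∫ x, ∫ y, f (T (x, y)) ∂ρ ∂μ := by
  rw [integral_map hT.aemeasurable hf.measurable.aestronglyMeasurable,
    integral_prod _ (integrable_comp_of_continuous _ hf hT)]

instance isProbabilityMeasure_plusNoise (μ : Measure (S → Bool)) [IsProbabilityMeasure μ]
    (ε : I) : IsProbabilityMeasure (plusNoise μ ε) :=
  Measure.isProbabilityMeasure_map (measurable_sup measurable_fst measurable_snd).aemeasurable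

instance isProbabilityMeasure_minusNoise (μ : Measure (S → Bool)) [IsProbabilityMeasure μ]
    (ε : I) : IsProbabilityMeasure (minusNoise μ ε) :=
  Measure.isProbabilityMeasure_map (measurable_sdiff measurable_fst measurable_snd).aemeasurable

lemma stochDom_map_of_le {Ω : Type*} [MeasurableSpace Ω] (P : Measure Ω) [IsFiniteMeasure P]
    {g h : Ω → S → Bool} (hg : Measurable g) (hh : Measurable h) (hle : ∀ ω, g ω ≤ h ω) :
    StochDom (P.map g) (P.map h) := fun f hf hm => by
  rw [integral_map hg.aemeasurable hf.measurable.aestronglyMeasurable,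
    integral_map hh.aemeasurable hf.measurable.aestronglyMeasurable]
  exact integral_mono (integrable_comp_of_continuous P hf hg)
    (integrable_comp_of_continuous P hf hh) fun ω => hm (hle ω)

lemma StochDom.map_prod {μ ν : Measure (S → Bool)} [IsFiniteMeasure μ] [IsFiniteMeasure ν]
    (h : StochDom μ ν) (ρ : Measure (S → Bool)) [IsFiniteMeasure ρ]
    {T : (S → Bool) × (S → Bool) → S → Bool} (hT : Continuous T)
    (hmono : ∀ y, Monotone fun x => T (x, y)) :
    StochDom ((μ.prod ρ).map T) ((ν.prod ρ).map T) := fun f hf hm => by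
  rw [integral_map_prod _ _ hT.measurable hf, integral_map_prod _ _ hT.measurable hf]
  obtain ⟨C, hC⟩ := isCompact_univ.exists_bound_of_continuousOn hf.continuousOn
  refine h _ (continuous_of_dominated (fun x => ?_) (fun x => .of_forall fun y => hC _ trivial)
    (integrable_const C) (.of_forall fun y => by fun_prop)) fun x x' hx => ?_
  · exact (hf.comp (hT.comp (by fun_prop))).measurable.aestronglyMeasurable
  · exact integral_mono (integrable_comp_of_continuous ρ hf (by fun_prop))
      (integrable_comp_of_continuous ρ hf (by fun_prop)) fun y => hm (hmono y hx)

lemma StochDom.vacant_le {μ ν : Measure (S → Bool)} [IsProbabilityMeasure μ]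
    [IsProbabilityMeasure ν] (h : StochDom μ ν) (F : Finset S) :
    ν.real (vacant F) ≤ μ.real (vacant F) := by
  have hopen := (isClopen_vacant F).compl
  have hind := h ((vacant F)ᶜ.indicator 1) (hopen.continuous_indicator continuous_one)
    (monotone_indicator_one_of_isUpperSet (isLowerSet_vacant F).compl)
  simp only [integral_indicator_one hopen.isOpen.measurableSet,
      probReal_compl_eq_one_sub (isClopen_vacant F).isOpen.measurableSet] at hind
  linarith

lemma minusNoise_stochDom (μ : Measure (S → Bool)) [IsProbabilityMeasure μ] (ε : I) :
    StochDom (minusNoise μ ε) μ := by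
  have h := stochDom_map_of_le (μ.prod (prodBer S ε)) (g := fun z => z.1 \ z.2) (by fun_prop)
    measurable_fst fun _ => sdiff_le
  rwa [Measure.map_fst_prod, measure_univ, one_smul] at h

lemma minusNoise_stochDom_prodBer (μ : Measure (S → Bool)) [IsProbabilityMeasure μ] (ε : I) :
    StochDom (minusNoise μ ε) (prodBer S (σ ε)) := by
  have h := stochDom_map_of_le (μ.prod (prodBer S ε)) (g := fun z => z.1 \ z.2)
    (h := fun z => z.2ᶜ) (by fun_prop) (by fun_prop) fun z => sdiff_eq.trans_le inf_le_right
  have hsnd : (μ.prod (prodBer S ε)).map (fun z => z.2ᶜ) = prodBer S (σ ε) := by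
    rw [← map_compl_prodBer]
    nth_rw 2 [← Measure.snd_prod (μ := μ) (ν := prodBer S ε)]
    rw [Measure.snd, Measure.map_map (by fun_prop) measurable_snd, Function.comp_def]
  rwa [hsnd] at h

lemma prodBer_zero_stochDom (μ : Measure (S → Bool)) [IsProbabilityMeasure μ] :
    StochDom (prodBer S 0) μ := by
  have h := stochDom_map_of_le μ (g := fun _ => ⊥) measurable_const measurable_id
    fun _ => bot_le
  rw [Measure.map_id, Measure.map_const, measure_univ, one_smul] at h
  simpa [prodBer, Measure.infinitePi_dirac] using! h

lemma prodBer_mono {p q : I} (h : p ≤ q) : StochDom (prodBer S p) (prodBer S q) := by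
  obtain ⟨c, rfl⟩ := exists_mul_eq_of_le h
  rw [← unitInterval.symm_symm c, ← minusNoise_prodBer]
  exact minusNoise_stochDom _ _

lemma StochDom.le_of_prodBer [Nonempty S] {p q : I} (h : StochDom (prodBer S p) (prodBer S q)) :
    p ≤ q := by
  obtain ⟨s⟩ := ‹Nonempty S›
  have := h.vacant_le {s}
  simp only [prodBer_real_vacant, Finset.card_singleton, pow_one, sub_le_sub_iff_left] at this
  exact this

end StochasticDomination

section Splicing

variable {S : Type*}

open Classical in
/-- The law of the configuration that agrees with a `ρ`-distributed configuration on `B` and with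
an independent `μ`-distributed configuration off `B`. -/
noncomputable def splice (B : Set S) (ρ μ : Measure (S → Bool)) : Measure (S → Bool) :=
  (μ.prod ρ).map fun z => B.piecewise z.2 z.1

lemma splice_eq_map (B : Set S) [DecidablePred (· ∈ B)] (ρ μ : Measure (S → Bool)) :
    splice B ρ μ = (μ.prod ρ).map fun z => B.piecewise z.2 z.1 := by
  rw [splice]
  congr!

lemma measurable_piecewise (B : Set S) [DecidablePred (· ∈ B)] {Ω : Type*} [MeasurableSpace Ω]
    {f g : Ω → S → Bool} (hf : Measurable f) (hg : Measurable g) :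
    Measurable fun ω => B.piecewise (f ω) (g ω) :=
  measurable_pi_lambda _ fun s => by
    by_cases hs : s ∈ B
    · simpa only [Set.piecewise_eq_of_mem _ _ _ hs] using by fun_prop
    · simpa only [Set.piecewise_eq_of_notMem _ _ _ hs] using by fun_prop

lemma continuous_piecewise_prod (B : Set S) [DecidablePred (· ∈ B)] :
    Continuous fun z : (S → Bool) × (S → Bool) => B.piecewise z.2 z.1 :=
  continuous_pi fun s => by
    by_cases hs : s ∈ B
    · simpa only [Set.piecewise_eq_of_mem _ _ _ hs] using by fun_prop
    · simpa only [Set.piecewise_eq_of_notMem _ _ _ hs] using by fun_prop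

instance isProbabilityMeasure_splice (B : Set S) (ρ μ : Measure (S → Bool))
    [IsProbabilityMeasure ρ] [IsProbabilityMeasure μ] : IsProbabilityMeasure (splice B ρ μ) := by
  classical
  exact Measure.isProbabilityMeasure_map
    (measurable_piecewise B measurable_snd measurable_fst).aemeasurable

lemma splice_prodBer_self (B : Set S) (p : I) :
    splice B (prodBer S p) (prodBer S p) = prodBer S p := by
  classical
  rw [splice, ← Measure.prod_swap, Measure.map_map
    (measurable_piecewise B measurable_snd measurable_fst) measurable_swap]
  exact map_piecewise_infinitePi _ B

lemma splice_empty (ρ μ : Measure (S → Bool)) [IsProbabilityMeasure ρ] :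
    splice ∅ ρ μ = μ := by
  simp [splice, Measure.map_fst_prod]

lemma splice_union {ρ : Measure (S → Bool)} [SFinite ρ] (μ : Measure (S → Bool)) [SFinite μ]
    {B B' : Set S} (hρ : splice B ρ ρ = ρ) :
    splice (B ∪ B') ρ μ = splice B ρ (splice B' ρ μ) := by
  classical
  have hpw (A : Set S) [DecidablePred (· ∈ A)] :
      Measurable fun z : (S → Bool) × (S → Bool) => A.piecewise z.2 z.1 :=
    measurable_piecewise A measurable_snd measurable_fst
  rw [splice_eq_map B ρ (splice B' ρ μ), splice_eq_map B', map_prod_map_left _ _ _ (hpw B') (hpw B),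
    splice_eq_map (B ∪ B')]
  nth_rw 1 [← hρ]
  rw [splice_eq_map B, map_prod_map_right _ _ _ (hpw B) (hpw (B ∪ B'))]
  congr 1 with z s
  by_cases hB : s ∈ B <;> by_cases hB' : s ∈ B' <;> simp [Set.piecewise, hB, hB']

lemma splice_minusNoise (B : Set S) (μ ν : Measure (S → Bool)) [SFinite μ] [SFinite ν] (ε : I) :
    splice B (minusNoise μ ε) (minusNoise ν ε) = minusNoise (splice B μ ν) ε := by
  classical
  have hpw : Measurable fun z : (S → Bool) × (S → Bool) => B.piecewise z.2 z.1 :=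
    measurable_piecewise B measurable_snd measurable_fst
  have hsd : Measurable fun z : (S → Bool) × (S → Bool) => z.1 \ z.2 := by fun_prop
  rw [minusNoise_eq_map (splice B μ ν), ← splice_prodBer_self B ε]
  simp only [splice_eq_map, minusNoise_eq_map]
  rw [Measure.map_prod_map _ _ hsd hsd, Measure.map_prod_map _ _ hpw hpw,
    Measure.map_map hpw (hsd.prodMap hsd), Measure.map_map hsd (hpw.prodMap hpw),
    ← prod_prod_prod_comm ν, Measure.map_map (hpw.comp (hsd.prodMap hsd)) (by fun_prop)]
  congr 1 with z s
  by_cases hs : s ∈ B <;> simp [Set.piecewise, hs]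

lemma splice_map_comp {J : Type*} (b : S → J) (B : Set J) (μ ν : Measure (J → Bool)) [SFinite μ]
    [SFinite ν] : splice (b ⁻¹' B) (μ.map (· ∘ b)) (ν.map (· ∘ b)) =
      (splice B μ ν).map (· ∘ b) := by
  classical
  have hb : Measurable fun x : J → Bool => x ∘ b := by fun_prop
  rw [splice_eq_map, splice_eq_map, Measure.map_prod_map _ _ hb hb,
    Measure.map_map (measurable_piecewise _ measurable_snd measurable_fst) (hb.prodMap hb),
    Measure.map_map hb (measurable_piecewise _ measurable_snd measurable_fst)]
  rfl

variable [Countable S]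

lemma integral_splice (B : Set S) [DecidablePred (· ∈ B)] (ρ μ : Measure (S → Bool))
    [IsFiniteMeasure ρ] [IsFiniteMeasure μ] {f : (S → Bool) → ℝ} (hf : Continuous f) :
    ∫ x, f x ∂splice B ρ μ = ∫ x, ∫ y, f (B.piecewise y x) ∂ρ ∂μ := by
  rw [splice_eq_map]
  exact integral_map_prod μ ρ (measurable_piecewise B measurable_snd measurable_fst) hf

lemma StochDom.splice {μ ν : Measure (S → Bool)} [IsFiniteMeasure μ] [IsFiniteMeasure ν]
    (h : StochDom μ ν) (B : Set S) (ρ : Measure (S → Bool)) [IsFiniteMeasure ρ] :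
    StochDom (splice B ρ μ) (splice B ρ ν) := by
  classical
  exact h.map_prod ρ (continuous_piecewise_prod B) fun y x x' hx =>
    Set.piecewise_mono (fun _ _ => le_rfl) fun s _ => hx s

variable {J : Type*} {b : S → J} {ρ μ : Measure (S → Bool)} [IsProbabilityMeasure ρ]
  [IsProbabilityMeasure μ]

lemma tendsto_integral_splice [Countable J] (b : S → J) (ρ μ : Measure (S → Bool))
    [IsProbabilityMeasure ρ] [IsProbabilityMeasure μ] {f : (S → Bool) → ℝ} (hf : Continuous f) :
    Tendsto (fun F : Finset J => ∫ x, f x ∂splice (b ⁻¹' F) ρ μ) atTop (𝓝 (∫ x, f x ∂ρ)) := by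
  classical
  obtain ⟨C, hC⟩ := isCompact_univ.exists_bound_of_continuousOn hf.continuousOn
  have hm (F : Finset J) := measurable_piecewise (b ⁻¹' (F : Set J))
    (measurable_snd (α := S → Bool)) (measurable_fst (β := S → Bool))
  have hlim (z : (S → Bool) × (S → Bool)) :
      Tendsto (fun F : Finset J => f ((b ⁻¹' (F : Set J)).piecewise z.2 z.1)) atTop
        (𝓝 (f z.2)) := by
    refine (hf.tendsto z.2).comp (tendsto_pi_nhds.2 fun s => tendsto_const_nhds.congr' ?_)
    filter_upwards [eventually_ge_atTop {b s}] with F hF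
    exact (Set.piecewise_eq_of_mem (b ⁻¹' F) _ _ (Finset.singleton_subset_iff.1 hF)).symm
  have h := tendsto_integral_filter_of_dominated_convergence (μ := μ.prod ρ) (fun _ => C)
    (.of_forall fun F => (integrable_comp_of_continuous _ hf (hm F)).aestronglyMeasurable)
    (.of_forall fun F => .of_forall fun z => hC _ (Set.mem_univ _)) (integrable_const C)
    (.of_forall hlim)
  have hsnd : ∫ z, f z.2 ∂μ.prod ρ = ∫ x, f x ∂ρ := by
    rw [integral_fun_snd, probReal_univ, one_smul]
  rw [hsnd] at h
  refine h.congr fun F => ?_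
  rw [splice, integral_map (hm F).aemeasurable hf.measurable.aestronglyMeasurable]

/-- Replacing the blocks one at a time increases the measure from `ρ` to `μ`. -/
lemma stochDom_of_splice_le [Countable J] (hρ : ∀ j, splice (b ⁻¹' {j}) ρ ρ = ρ)
    (h : ∀ j, StochDom (splice (b ⁻¹' {j}) ρ μ) μ) : StochDom ρ μ := by
  classical
  have finite (F : Finset J) : StochDom (splice (b ⁻¹' F) ρ μ) μ := by
    induction F using Finset.induction_on with
    | empty =>
      rw [Finset.coe_empty, Set.preimage_empty, splice_empty]
      exact fun _ _ _ => le_rfl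
    | insert j F _ ih =>
      rw [Finset.coe_insert, Set.insert_eq, Set.preimage_union, splice_union μ (hρ j)]
      exact (ih.splice _ ρ).trans (h j)
  exact fun f hf hm => le_of_tendsto (tendsto_integral_splice b ρ μ hf)
    (.of_forall fun F => finite F f hf hm)

lemma stochDom_of_block_le [Countable J] (hρ : ∀ j, splice (b ⁻¹' {j}) ρ ρ = ρ)
    (hμ : ∀ j, splice (b ⁻¹' {j}) μ μ = μ)
    (h : ∀ j (f : (S → Bool) → ℝ), Continuous f → Monotone f → DependsOn f (b ⁻¹' {j}) →
      ∫ x, f x ∂ρ ≤ ∫ x, f x ∂μ) : StochDom ρ μ := by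
  classical
  refine stochDom_of_splice_le hρ fun j f hf hm => ?_
  have hint (κ : Measure (S → Bool)) [IsProbabilityMeasure κ] :
      Integrable (fun x => ∫ y, f ((b ⁻¹' {j}).piecewise y x) ∂κ) μ :=
    (integrable_comp_of_continuous (μ.prod κ) hf
      (measurable_piecewise _ measurable_snd measurable_fst)).integral_prod_left
  calc ∫ x, f x ∂splice (b ⁻¹' {j}) ρ μ = ∫ x, ∫ y, f ((b ⁻¹' {j}).piecewise y x) ∂ρ ∂μ :=
        integral_splice _ _ _ hf
    _ ≤ ∫ x, ∫ y, f ((b ⁻¹' {j}).piecewise y x) ∂μ ∂μ :=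
        integral_mono (hint ρ) (hint μ) fun x => h j _
          (hf.comp ((continuous_piecewise_prod _).comp (by fun_prop : Continuous fun y => (x, y))))
          (fun y y' hy => hm (Set.piecewise_mono (fun s _ => hy s) fun _ _ => le_rfl))
          fun y y' hy => congrArg f (funext fun s => by
            by_cases hs : s ∈ b ⁻¹' {j} <;> simp [hs, hy])
    _ = ∫ x, f x ∂μ := by rw [← integral_splice _ _ _ hf, hμ]

end Splicing

section InsertionTolerance

variable {S : Type*} {μ : Measure (S → Bool)} [IsProbabilityMeasure μ]

lemma measurableSet_cylinderEvents_occupied (s : S) :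
    MeasurableSet[cylinderEvents {s}] {x : S → Bool | x s = true} :=
  measurableSet_eq_fun (m := cylinderEvents {s})
    (measurable_cylinderEvent_apply (Set.mem_singleton s)) (@measurable_const _ _ _ (_) _)

lemma measurableSet_occupied (s : S) : MeasurableSet {x : S → Bool | x s = true} :=
  cylinderEvents_le_pi _ (measurableSet_cylinderEvents_occupied s)

lemma insertionTolerant_of_forall_measureReal_le {ε : ℝ}
    (h : ∀ (s : S) (A : Set (S → Bool)), MeasurableSet[cylinderEvents {s}ᶜ] A →
      ε * μ.real A ≤ μ.real (A ∩ {x | x s = true})) : InsertionTolerant μ ε := fun s => by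
  have hm : cylinderEvents (X := fun _ : S => Bool) {s}ᶜ ≤ MeasurableSpace.pi :=
    cylinderEvents_le_pi
  have hE := measurableSet_occupied s
  refine ae_of_ae_trim hm (ae_le_of_forall_setIntegral_le (integrable_const ε)
    (integrable_condExp.trim hm stronglyMeasurable_condExp) fun A hA _ => ?_)
  rw [← setIntegral_trim hm stronglyMeasurable_const hA,
    ← setIntegral_trim hm stronglyMeasurable_condExp hA,
    setIntegral_condExp hm ((integrable_const 1).indicator hE) hA, setIntegral_indicator hE,
    setIntegral_const, setIntegral_const, smul_eq_mul, mul_comm, smul_eq_mul, mul_one]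
  exact h s A hA

lemma InsertionTolerant.integral_le {ε : ℝ} (h : InsertionTolerant μ ε) (s : S)
    {D : (S → Bool) → ℝ} (hD : StronglyMeasurable[cylinderEvents {s}ᶜ] D)
    (hDi : Integrable D μ) (h0 : 0 ≤ D) :
    ε * ∫ x, D x ∂μ ≤ ∫ x in {x | x s = true}, D x ∂μ := by
  let E : Set (S → Bool) := {x | x s = true}
  have hE : MeasurableSet E := measurableSet_occupied s
  have hDE : D * E.indicator (fun _ => 1) = E.indicator D := by
    funext x
    by_cases hx : x ∈ E <;> simp [hx]
  have pull_out : μ[E.indicator D | cylinderEvents {s}ᶜ] =ᵐ[μ]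
      D * μ⟦E | cylinderEvents {s}ᶜ⟧ := by
    rw [← hDE]
    exact condExp_mul_of_stronglyMeasurable_left hD (hDE ▸ hDi.indicator hE)
      ((integrable_const 1).indicator hE)
  calc ε * ∫ x, D x ∂μ = ∫ x, ε * D x ∂μ := (integral_const_mul ε D).symm
    _ ≤ ∫ x, (D * μ⟦E | cylinderEvents {s}ᶜ⟧) x ∂μ := by
      refine integral_mono_ae (hDi.const_mul ε) (integrable_condExp.congr pull_out) ?_
      filter_upwards [h s] with x hx
      rw [mul_comm]
      exact mul_le_mul_of_nonneg_left hx (h0 x)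
    _ = ∫ x in E, D x ∂μ := by
      rw [← integral_congr_ae pull_out, integral_condExp cylinderEvents_le_pi,
        integral_indicator hE]

lemma InsertionTolerant.measureReal_le {ε : ℝ} (h : InsertionTolerant μ ε) (s : S)
    {A : Set (S → Bool)} (hA : MeasurableSet[cylinderEvents {s}ᶜ] A) :
    ε * μ.real A ≤ μ.real (A ∩ {x | x s = true}) := by
  have hA' : MeasurableSet A := cylinderEvents_le_pi _ hA
  have := h.integral_le s (D := A.indicator 1) (stronglyMeasurable_one.indicator hA)
    ((integrable_const 1).indicator hA') (Set.indicator_nonneg fun _ _ => zero_le_one)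
  rwa [integral_indicator_one hA', integral_indicator_one hA',
    measureReal_restrict_apply hA'] at this

lemma measurable_update_of_compl [DecidableEq S] (s : S) (b : Bool) :
    Measurable[cylinderEvents {s}ᶜ] fun x : S → Bool => Function.update x s b := by
  refine @measurable_pi_lambda _ _ _ (_) _ _ fun t => ?_
  by_cases ht : t = s
  · subst ht
    simp only [Function.update_self]
    exact @measurable_const _ _ _ (_) _
  · simp only [Function.update_of_ne ht]
    exact measurable_cylinderEvent_apply ht

variable [Countable S]

theorem InsertionTolerant.stochDom {p : I} (h : InsertionTolerant μ p) :
    StochDom (prodBer S p) μ := by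
  classical
  refine stochDom_of_splice_le (b := id) (fun s => splice_prodBer_self _ p) fun s f hf hm => ?_
  have hcont (b : Bool) : Continuous fun x : S → Bool => f (Function.update x s b) :=
    hf.comp (continuous_id.update s continuous_const)
  have hint (b : Bool) : Integrable (fun x : S → Bool => f (Function.update x s b)) μ :=
    integrable_comp_of_continuous μ (hcont b) measurable_id
  have hmeas (b : Bool) : StronglyMeasurable[cylinderEvents {s}ᶜ]
      fun x : S → Bool => f (Function.update x s b) :=
    (hf.measurable.comp (measurable_update_of_compl s b)).stronglyMeasurable
  let D (x : S → Bool) : ℝ := f (Function.update x s true) - f (Function.update x s false)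
  have hD : Integrable D μ := (hint true).sub (hint false)
  have tolerance := h.integral_le s (D := D) ((hmeas true).sub (hmeas false)) hD
    fun x => sub_nonneg.2 (hm (Function.update_mono (Bool.false_le _)))
  have resampled (x : S → Bool) : ∫ y, f ((id ⁻¹' {s}).piecewise y x) ∂prodBer S p =
      p * D x + f (Function.update x s false) := by
    simp only [Set.preimage_id_eq, id, Set.piecewise_singleton]
    rw [integral_eval_prodBer p s fun b => f (Function.update x s b)]
    ring
  have split (x : S → Bool) :
      {x | x s = true}.indicator D x + f (Function.update x s false) = f x := by
    cases hx : x s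
    · have : Function.update x s false = x := hx ▸ Function.update_eq_self s x
      simp [hx, this]
    · have : Function.update x s true = x := hx ▸ Function.update_eq_self s x
      simp [D, hx, this]
  calc ∫ x, f x ∂splice (id ⁻¹' {s}) (prodBer S p) μ
      = p * ∫ x, D x ∂μ + ∫ x, f (Function.update x s false) ∂μ := by
        rw [integral_splice _ _ _ hf, integral_congr_ae (.of_forall resampled),
          integral_add (hD.const_mul _) (hint false), integral_const_mul]
    _ ≤ ∫ x in {x | x s = true}, D x ∂μ + ∫ x, f (Function.update x s false) ∂μ := by gcongr
    _ = ∫ x, f x ∂μ := by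
        rw [← integral_indicator (measurableSet_occupied s),
          ← integral_add (hD.indicator (measurableSet_occupied s)) (hint false)]
        exact integral_congr_ae (.of_forall split)

theorem UniformlyInsertionTolerant.dominatesProduct (h : UniformlyInsertionTolerant μ) :
    DominatesProduct μ := by
  obtain ⟨ε, h0, h⟩ := h
  refine ⟨⟨min ε 1, by positivity, min_le_right _ _⟩, Subtype.coe_lt_coe.1 (by simpa using h0),
    InsertionTolerant.stochDom fun s => ?_⟩
  filter_upwards [h s] with x hx using (min_le_left _ _).trans hx

theorem insertionTolerant_plusNoise (ν : Measure (S → Bool)) [IsProbabilityMeasure ν] (ε : I) :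
    InsertionTolerant (plusNoise ν ε) ε := by
  refine insertionTolerant_of_forall_measureReal_le fun s A hA => ?_
  have hA' : MeasurableSet A := cylinderEvents_le_pi _ hA
  have hE := measurableSet_occupied s
  have hsup : Measurable fun z : (S → Bool) × (S → Bool) => z.1 ⊔ z.2 := by fun_prop
  have indep (x : S → Bool) : prodBer S ε ((x ⊔ ·) ⁻¹' A ∩ {y | y s = true}) =
      prodBer S ε ((x ⊔ ·) ⁻¹' A) * prodBer S ε {y | y s = true} := by
    have hx : Measurable[cylinderEvents {s}ᶜ, cylinderEvents {s}ᶜ] fun y : S → Bool => x ⊔ y :=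
      (@measurable_cylinderEvents_iff _ _ _ (_) _ _ _).2 fun t ht =>
        (measurable_of_countable (x t ⊔ ·)).comp (measurable_cylinderEvent_apply ht)
    exact (Indep_iff _ _ _).1 (indep_cylinderEvents_infinitePi _ disjoint_compl_left) _ _ (hx hA)
      (measurableSet_cylinderEvents_occupied s)
  have hP : (ν.prod (prodBer S ε)) ((fun z => z.1 ⊔ z.2) ⁻¹' A ∩ Prod.snd ⁻¹' {y | y s = true}) =
      (ν.prod (prodBer S ε)) ((fun z => z.1 ⊔ z.2) ⁻¹' A) * prodBer S ε {y | y s = true} := by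
    rw [Measure.prod_apply ((hsup hA').inter (measurable_snd hE)), Measure.prod_apply (hsup hA'),
      ← lintegral_mul_const _ (measurable_measure_prodMk_left (hsup hA'))]
    exact lintegral_congr indep
  have hε : (prodBer S ε).real {y | y s = true} = ε := by
    simpa using prodBer_real_forall_eq ε {s} true
  rw [plusNoise_eq_map, map_measureReal_apply hsup hA',
    map_measureReal_apply hsup (hA'.inter hE)]
  calc ε * (ν.prod (prodBer S ε)).real ((fun z => z.1 ⊔ z.2) ⁻¹' A)
      = (ν.prod (prodBer S ε)).real
          ((fun z => z.1 ⊔ z.2) ⁻¹' A ∩ Prod.snd ⁻¹' {y | y s = true}) := by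
        rw [measureReal_def _ (_ ∩ _), hP, ENNReal.toReal_mul, ← measureReal_def,
          ← measureReal_def, hε, mul_comm]
    _ ≤ (ν.prod (prodBer S ε)).real ((fun z => z.1 ⊔ z.2) ⁻¹' (A ∩ {x | x s = true})) :=
        measureReal_mono fun z hz => ⟨hz.1, by
          have : z.2 s = true := hz.2
          simp [this]⟩

theorem UniformlyUpwardsExtractable.uniformlyInsertionTolerant {μ : Measure (S → Bool)}
    (h : UniformlyUpwardsExtractable μ) : UniformlyInsertionTolerant μ := by
  obtain ⟨ε, h0, -, ν, hν, rfl⟩ := h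
  exact ⟨ε, h0, insertionTolerant_plusNoise ν ε⟩

end InsertionTolerance

section Rigidity

variable {S : Type*}

lemma plusNoise_plusNoise (μ : Measure (S → Bool)) [SFinite μ] (p q : I) :
    plusNoise (plusNoise μ p) q = plusNoise μ (σ (σ p * σ q)) := by
  have hsup : Measurable fun z : (S → Bool) × (S → Bool) => z.1 ⊔ z.2 := by fun_prop
  rw [plusNoise_eq_map, plusNoise_eq_map, plusNoise_eq_map, map_prod_map_left _ _ _ hsup hsup,
    ← plusNoise_prodBer, plusNoise_eq_map, map_prod_map_right _ _ _ hsup hsup]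
  simp only [sup_assoc]

variable [Countable S]

lemma StochDom.plusNoise {μ ν : Measure (S → Bool)} [IsProbabilityMeasure μ]
    [IsProbabilityMeasure ν] (h : StochDom μ ν) (ε : I) :
    StochDom (plusNoise μ ε) (plusNoise ν ε) :=
  h.map_prod (prodBer S ε) (T := fun z => z.1 ⊔ z.2)
    (continuous_pi fun s => (continuous_of_discreteTopology (f := fun a : Bool × Bool =>
      a.1 ⊔ a.2)).comp (by fun_prop : Continuous fun z : (S → Bool) × (S → Bool) => (z.1 s, z.2 s)))
    fun y _ _ hx => sup_le_sup_right hx y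

lemma minusNoise_plusNoise_stochDom (ν : Measure (S → Bool)) [IsProbabilityMeasure ν] (ε δ : I) :
    StochDom (minusNoise (plusNoise ν ε) δ) (plusNoise ν (ε * σ δ)) := by
  have hsup : Measurable fun z : (S → Bool) × (S → Bool) => z.1 ⊔ z.2 := by fun_prop
  have hsdiff : Measurable fun z : (S → Bool) × (S → Bool) => z.1 \ z.2 := by fun_prop
  rw [minusNoise_eq_map, plusNoise_eq_map, map_prod_map_left _ _ _ hsup hsdiff,
    plusNoise_eq_map, ← minusNoise_prodBer, minusNoise_eq_map, map_prod_map_right _ _ _ hsdiff hsup]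
  refine stochDom_map_of_le _ (by fun_prop) (by fun_prop) fun z => ?_
  rw [sup_sdiff]
  exact sup_le_sup_right sdiff_le _

/-- If `π_{pMax}` survived below a minus noise, a small plus noise could be added to it. -/
theorem UniformlyUpwardsExtractable.rigid [Nonempty S] {μ : Measure (S → Bool)}
    (h : UniformlyUpwardsExtractable μ) : Rigid μ := by
  obtain ⟨ε, hε0, -, ν, hν, rfl⟩ := h
  rintro ⟨-, δ, hδ0, -, hδ⟩
  set m := pMax (plusNoise ν ε)
  have hm : m ≤ σ δ := (hδ.trans (minusNoise_stochDom_prodBer _ δ)).le_of_prodBer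
  obtain ⟨c, hc⟩ : ∃ c, σ (ε * σ δ) * c = σ ε :=
    exists_mul_eq_of_le (unitInterval.symm_le_symm.2 unitInterval.mul_le_left)
  have dominated : StochDom (prodBer S (σ (σ m * c))) (plusNoise ν ε) := by
    have hle := (hδ.trans (minusNoise_plusNoise_stochDom ν ε δ)).plusNoise (σ c)
    rwa [plusNoise_plusNoise, plusNoise_prodBer, unitInterval.symm_symm, hc,
      unitInterval.symm_symm] at hle
  have hmax : σ (σ m * c) ≤ m := le_sSup dominated
  have hm1 : (m : ℝ) < 1 := lt_of_le_of_lt (b := 1 - (δ : ℝ)) hm (sub_lt_self 1 hδ0)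
  have hc1 : (c : ℝ) < 1 := by
    have hc' : (1 - (ε : ℝ) * (1 - δ)) * c = 1 - ε := congrArg Subtype.val hc
    have : 0 < (ε : ℝ) * δ := mul_pos hε0 hδ0
    nlinarith [ε.2.2]
  have hmax' : 1 - (1 - (m : ℝ)) * c ≤ m := hmax
  linarith [mul_pos (sub_pos.2 hm1) (sub_pos.2 hc1)]

/-- The parameter `1/2`. -/
noncomputable def half : I := ⟨1 / 2, by norm_num, by norm_num⟩

lemma half_pos : 0 < half := Subtype.coe_lt_coe.1 (by norm_num [half])

lemma half_lt_one : half < 1 := Subtype.coe_lt_coe.1 (by norm_num [half])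

theorem Rigid.dominatesProduct {μ : Measure (S → Bool)} [IsProbabilityMeasure μ]
    (h : Rigid μ) : DominatesProduct μ := by
  by_contra hd
  have h0 : pMax μ = 0 := bot_unique <| sSup_le fun p hp => not_lt.1 fun hp0 => hd ⟨p, hp0, hp⟩
  exact h ⟨h0 ▸ prodBer_zero_stochDom μ, half, half_pos, half_lt_one, h0 ▸ prodBer_zero_stochDom _⟩

end Rigidity

section Translations

lemma measurable_shift (k : ℤ) : Measurable fun (x : ℤ → Bool) (i : ℤ) => x (i + k) :=
  measurable_pi_lambda _ fun i => measurable_pi_apply (i + k)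

lemma translationInvariant_of_shift_one {μ : Measure (ℤ → Bool)}
    (h : μ.map (fun (x : ℤ → Bool) (i : ℤ) => x (i + 1)) = μ) : TranslationInvariant μ := by
  have hcomp (k l : ℤ) : (μ.map fun (x : ℤ → Bool) (i : ℤ) => x (i + k)).map
      (fun (x : ℤ → Bool) (i : ℤ) => x (i + l)) = μ.map fun x i => x (i + (k + l)) := by
    rw [Measure.map_map (measurable_shift l) (measurable_shift k)]
    simp only [Function.comp_def, add_assoc, add_comm l k]
  intro k
  induction k using Int.induction_on with
  | zero => simp
  | succ k ih => rw [add_comm, ← hcomp, h, ih]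
  | pred k ih =>
    conv_lhs => rw [← h]
    rw [hcomp, add_sub_cancel, ih]

lemma map_shift_prodBer (p : I) (k : ℤ) :
    (prodBer ℤ p).map (fun (x : ℤ → Bool) (i : ℤ) => x (i + k)) = prodBer ℤ p :=
  map_comp_prodBer p (add_left_injective k)

end Translations

section NeighbourMaximum

lemma le_of_frequently_mul_pow_le {c x y : ℝ} (hc : 0 < c) (hy : 0 ≤ y)
    (h : ∃ᶠ n in atTop, c * x ^ n ≤ y ^ n) : x ≤ y := by
  by_contra! hxy
  have hx : 0 < x := hy.trans_lt hxy
  have ratio : Tendsto (fun n : ℕ => (y / x) ^ n) atTop (𝓝 0) :=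
    tendsto_pow_atTop_nhds_zero_of_lt_one (by positivity) ((div_lt_one hx).2 hxy)
  obtain ⟨n, hn, hlt⟩ := (h.and_eventually (ratio.eventually_lt_const hc)).exists
  rw [div_pow, div_lt_iff₀ (pow_pos hx n)] at hlt
  exact hn.not_gt hlt

variable {S : Type*}

lemma measurableSet_cylinderEvents_vacant {F : Finset S} {Δ : Set S} (h : ↑F ⊆ Δ) :
    MeasurableSet[cylinderEvents Δ] (vacant F) := by
  rw [vacant_eq_biInter]
  exact .biInter F.countable_toSet fun s hs =>
    measurable_cylinderEvent_apply (h hs) (measurableSet_singleton false)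

lemma measurableSet_vacant (F : Finset S) : MeasurableSet (vacant F) :=
  cylinderEvents_le_pi _ (measurableSet_cylinderEvents_vacant subset_rfl)

lemma minusNoise_real_vacant [Countable S] (μ : Measure (S → Bool)) [IsProbabilityMeasure μ]
    (ε : I) (F : Finset S) : (minusNoise μ ε).real (vacant F) =
      ∫ x, ∏ s ∈ F, (if x s then (ε : ℝ) else 1) ∂μ := by
  have factor (x y : S → Bool) : (vacant F).indicator (1 : (S → Bool) → ℝ) (x \ y) =
      ∏ s ∈ F, if x s && !y s then (0 : ℝ) else 1 := by
    classical
    simp only [← Bool.not_eq_false, ite_not, Finset.prod_ite_zero, Finset.prod_const_one,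
      Set.indicator_apply]
    exact if_congr Iff.rfl rfl rfl
  rw [← integral_indicator_one (measurableSet_vacant F), minusNoise_eq_map,
    integral_map_prod _ _ (by fun_prop) ((isClopen_vacant F).continuous_indicator
      continuous_one)]
  congr with x
  simp only [factor]
  rw [prodBer, integral_finsetProd_infinitePi _ F
    (φ := fun s b => if x s && !b then (0 : ℝ) else 1) fun _ => measurable_of_countable _]
  refine Finset.prod_congr rfl fun s _ => ?_
  rw [integral_bernoulliMeasure_true_false]
  cases x s <;> simp

/-- The maxima of the pairs of neighbouring sites of a configuration on `ℤ`. -/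
def neighbourMax (u : ℤ → Bool) (i : ℤ) : Bool := u i || u (i + 1)

lemma measurable_neighbourMax : Measurable neighbourMax :=
  measurable_bool_map₂ (· || ·) measurable_id (measurable_shift 1)

/-- The law of the maxima of neighbouring pairs of independent fair bits: it is rigid, but a site
between two `0`s must be a `0`. -/
noncomputable def neighbourMaxLaw : Measure (ℤ → Bool) := (prodBer ℤ half).map neighbourMax

instance isProbabilityMeasure_neighbourMaxLaw : IsProbabilityMeasure neighbourMaxLaw :=
  Measure.isProbabilityMeasure_map measurable_neighbourMax.aemeasurable

lemma neighbourMaxLaw_translationInvariant : TranslationInvariant neighbourMaxLaw := fun k => by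
  have commute : (fun (x : ℤ → Bool) (i : ℤ) => x (i + k)) ∘ neighbourMax =
      neighbourMax ∘ fun (x : ℤ → Bool) (i : ℤ) => x (i + k) := by
    funext u i
    simp only [Function.comp_apply, neighbourMax, add_right_comm]
  rw [neighbourMaxLaw, Measure.map_map (measurable_shift k) measurable_neighbourMax, commute,
    ← Measure.map_map measurable_neighbourMax (measurable_shift k), map_shift_prodBer]

lemma neighbourMaxLaw_not_uniformlyInsertionTolerant :
    ¬ UniformlyInsertionTolerant neighbourMaxLaw := by
  rintro ⟨ε, hε, h⟩
  have hsub : (({-1, 1} : Finset ℤ) : Set ℤ) ⊆ {0}ᶜ := by simp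
  have tolerance := h.measureReal_le 0 (measurableSet_cylinderEvents_vacant hsub)
  have hpre : neighbourMax ⁻¹' vacant {-1, 1} = vacant {-1, 0, 1, 2} := by
    ext u
    simp [neighbourMax, vacant, and_assoc]
  have hpos : neighbourMaxLaw.real (vacant {-1, 1}) = (1 / 2) ^ 4 := by
    rw [neighbourMaxLaw, map_measureReal_apply measurable_neighbourMax
      (measurableSet_vacant _), hpre, prodBer_real_vacant]
    norm_num [half]
  have hnull : neighbourMaxLaw.real (vacant {-1, 1} ∩ {x | x 0 = true}) = 0 := by
    rw [neighbourMaxLaw, map_measureReal_apply measurable_neighbourMax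
      ((measurableSet_vacant _).inter (measurableSet_occupied 0)), Set.preimage_inter,
      hpre]
    convert measureReal_empty
    ext u
    simp +contextual [neighbourMax, vacant]
  rw [hpos, hnull] at tolerance
  linarith

lemma prod_neighbourMax_ge (ε : I) (L : ℕ) (u : ℤ → Bool) :
    ∏ i ∈ Finset.Ico (0 : ℤ) (L + 1), (if u i then ((ε * ε : I) : ℝ) else 1) ≤
      ∏ i ∈ Finset.Ico (0 : ℤ) L, if neighbourMax u i then (ε : ℝ) else 1 := by
  let g (b : Bool) : ℝ := if b then ε else 1
  have hg0 (b : Bool) : 0 ≤ g b := by cases b <;> simp [g, ε.2.1]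
  have hg1 (b : Bool) : g b ≤ 1 := by cases b <;> simp [g, ε.2.2]
  have hg (a b : Bool) : g a * g b ≤ g (a || b) := by
    cases a <;> cases b <;> simp [g, mul_le_of_le_one_left ε.2.1 ε.2.2]
  have shifted : ∏ i ∈ Finset.Ico (0 : ℤ) L, g (u (i + 1)) =
      ∏ i ∈ Finset.Ico (1 : ℤ) (L + 1), g (u i) := by
    rw [Finset.prod_Ico_add' (fun i => g (u i)), zero_add]
  have restrict {a b : ℤ} (h : Finset.Ico a b ⊆ Finset.Ico 0 (L + 1)) :
      ∏ i ∈ Finset.Ico (0 : ℤ) (L + 1), g (u i) ≤ ∏ i ∈ Finset.Ico a b, g (u i) :=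
    Finset.prod_le_prod_of_subset_of_le_one h (fun _ _ => hg0 _) fun _ _ _ => hg1 _
  calc ∏ i ∈ Finset.Ico (0 : ℤ) (L + 1), (if u i then ((ε * ε : I) : ℝ) else 1)
      = (∏ i ∈ Finset.Ico (0 : ℤ) (L + 1), g (u i)) *
          ∏ i ∈ Finset.Ico (0 : ℤ) (L + 1), g (u i) := by
        rw [← Finset.prod_mul_distrib]
        exact Finset.prod_congr rfl fun i _ => by cases u i <;> simp [g]
    _ ≤ (∏ i ∈ Finset.Ico (0 : ℤ) L, g (u i)) * ∏ i ∈ Finset.Ico (1 : ℤ) (L + 1), g (u i) :=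
        mul_le_mul (restrict (Finset.Ico_subset_Ico_right (by lia)))
          (restrict (Finset.Ico_subset_Ico_left zero_le_one))
          (Finset.prod_nonneg fun _ _ => hg0 _) (Finset.prod_nonneg fun _ _ => hg0 _)
    _ ≤ ∏ i ∈ Finset.Ico (0 : ℤ) L, g (neighbourMax u i) := by
        rw [← shifted, ← Finset.prod_mul_distrib]
        exact Finset.prod_le_prod (fun _ _ => mul_nonneg (hg0 _) (hg0 _)) fun _ _ => hg _ _

lemma pow_le_minusNoise_neighbourMaxLaw_vacant (ε : I) (L : ℕ) :
    (1 - 1 / 2 * (1 - (ε : ℝ) ^ 2)) ^ (L + 1) ≤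
      (minusNoise neighbourMaxLaw ε).real (vacant (Finset.Ico (0 : ℤ) L)) := by
  have hcont (δ : I) (F : Finset ℤ) :
      Continuous fun x : ℤ → Bool => ∏ s ∈ F, if x s then (δ : ℝ) else 1 :=
    continuous_finsetProd _ fun s _ =>
      (continuous_of_discreteTopology (f := fun b : Bool => if b then (δ : ℝ) else 1)).comp
        (continuous_apply s)
  calc (1 - 1 / 2 * (1 - (ε : ℝ) ^ 2)) ^ (L + 1)
      = (minusNoise (prodBer ℤ half) (ε * ε)).real (vacant (Finset.Ico (0 : ℤ) (L + 1))) := by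
        rw [minusNoise_prodBer, prodBer_real_vacant]
        simp [half, sq]
    _ ≤ ∫ u, ∏ i ∈ Finset.Ico (0 : ℤ) L, (if neighbourMax u i then (ε : ℝ) else 1)
          ∂prodBer ℤ half := by
        rw [minusNoise_real_vacant]
        exact integral_mono (integrable_comp_of_continuous _ (hcont _ _) measurable_id)
          (integrable_comp_of_continuous _ (hcont _ _) measurable_neighbourMax)
          (prod_neighbourMax_ge ε L)
    _ = (minusNoise neighbourMaxLaw ε).real (vacant (Finset.Ico (0 : ℤ) L)) := by
        rw [minusNoise_real_vacant, neighbourMaxLaw,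
          integral_map measurable_neighbourMax.aemeasurable
            (hcont _ _).measurable.aestronglyMeasurable]

lemma half_le_pMax_neighbourMaxLaw : half ≤ pMax neighbourMaxLaw := le_sSup <| by
  have := stochDom_map_of_le (prodBer ℤ half) measurable_id measurable_neighbourMax
    fun u i => Bool.left_le_or (u i) (u (i + 1))
  rwa [Measure.map_id] at this

/-- Thinned by `ε`, a vacant interval of length `L` has probability at least `r ^ (L + 1)` for
some `r > 1/2`, which is more than `π_{1/2}` allows. -/
lemma neighbourMaxLaw_rigid : Rigid neighbourMaxLaw := by
  rintro ⟨-, ε, hε, -, hdom⟩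
  have hε' : 0 < (ε : ℝ) ^ 2 := pow_pos hε 2
  have hmax : (1 / 2 : ℝ) ≤ pMax neighbourMaxLaw := half_le_pMax_neighbourMaxLaw
  have rate : 1 - 1 / 2 * (1 - (ε : ℝ) ^ 2) ≤ 1 / 2 := by
    refine le_of_frequently_mul_pow_le (c := 1 - 1 / 2 * (1 - (ε : ℝ) ^ 2)) (by linarith)
      (by norm_num) (Frequently.of_forall fun L => ?_)
    calc _ = (1 - 1 / 2 * (1 - (ε : ℝ) ^ 2)) ^ (L + 1) := (pow_succ' _ _).symm
      _ ≤ (prodBer ℤ (pMax neighbourMaxLaw)).real (vacant (Finset.Ico (0 : ℤ) L)) :=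
        (pow_le_minusNoise_neighbourMaxLaw_vacant ε L).trans (hdom.vacant_le _)
      _ ≤ (1 / 2) ^ L := by
        rw [prodBer_real_vacant, Int.card_Ico, sub_zero, Int.toNat_natCast]
        exact pow_le_pow_left₀ (sub_nonneg.2 (pMax neighbourMaxLaw).2.2) (by linarith) L
  linarith

end NeighbourMaximum

section Mixtures

variable {κ : Type*} {Ω Ω' : Type*} [MeasurableSpace Ω] [MeasurableSpace Ω']

/-- The mixture of the measures `m k` with weights `c k`. -/
noncomputable def mixture (c : PMF κ) (m : κ → Measure Ω) : Measure Ω :=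
  Measure.sum fun k => c k • m k

section Basic

variable (c : PMF κ) (m : κ → Measure Ω)

lemma mixture_apply {A : Set Ω} (hA : MeasurableSet A) : mixture c m A = ∑' k, c k * m k A := by
  simp only [mixture, Measure.sum_apply _ hA, Measure.smul_apply, smul_eq_mul]

variable {m} in
lemma mixture_le_smul {m' : κ → Measure Ω} {K : ℝ≥0} (h : ∀ k, m k ≤ K • m' k) :
    mixture c m ≤ K • mixture c m' := Measure.le_iff.2 fun A hA => by
  rw [Measure.smul_apply, mixture_apply c m hA, mixture_apply c m' hA, ENNReal.smul_def,
    smul_eq_mul, ← ENNReal.tsum_mul_left]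
  refine ENNReal.tsum_le_tsum fun k => ?_
  rw [mul_left_comm]
  gcongr
  exact h k A

lemma map_mixture {g : Ω → Ω'} (hg : Measurable g) :
    (mixture c m).map g = mixture c fun k => (m k).map g := by
  rw [mixture, Measure.map_sum hg.aemeasurable]
  simp only [Measure.map_smul, mixture]

lemma mixture_comp_equiv (e : κ ≃ κ) (hc : ∀ k, c (e k) = c k) :
    mixture c (m ∘ e) = mixture c m := by
  rw [mixture, mixture, ← Measure.sum_comp_equiv e fun k => c k • m k]
  simp only [Function.comp_def, hc]

lemma hasSum_integral_mixture {f : Ω → ℝ} (hf : Integrable f (mixture c m)) :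
    HasSum (fun k => (c k).toReal * ∫ ω, f ω ∂m k) (∫ ω, f ω ∂mixture c m) := by
  have h := hasSum_integral_measure hf
  simp only [integral_smul_measure, smul_eq_mul] at h
  exact h

lemma integral_mixture_nonneg {f : Ω → ℝ} (hf : Integrable f (mixture c m))
    (h : ∀ k, 0 ≤ ∫ ω, f ω ∂m k) : 0 ≤ ∫ ω, f ω ∂mixture c m :=
  (hasSum_integral_mixture c m hf).nonneg fun k => mul_nonneg ENNReal.toReal_nonneg (h k)

lemma mul_le_integral_mixture {f : Ω → ℝ} (hf : Integrable f (mixture c m))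
    (h : ∀ k, 0 ≤ ∫ ω, f ω ∂m k) (k : κ) :
    (c k).toReal * ∫ ω, f ω ∂m k ≤ ∫ ω, f ω ∂mixture c m :=
  le_hasSum (hasSum_integral_mixture c m hf) k fun l _ =>
    mul_nonneg ENNReal.toReal_nonneg (h l)

instance isProbabilityMeasure_mixture [∀ k, IsProbabilityMeasure (m k)] :
    IsProbabilityMeasure (mixture c m) :=
  ⟨by simp [mixture_apply c m .univ, c.tsum_coe]⟩

lemma mul_measureReal_le_mixture [∀ k, IsProbabilityMeasure (m k)] (k : κ) (A : Set Ω) :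
    (c k).toReal * (m k).real A ≤ (mixture c m).real A := by
  rw [measureReal_def, ← ENNReal.toReal_mul]
  exact ENNReal.toReal_mono (measure_ne_top _ _) (Measure.le_sum (fun k => c k • m k) k A)

end Basic

section Configurations

variable {S : Type*} [Countable S] (c : PMF κ) {m : κ → Measure (S → Bool)}

lemma StochDom.mixture [∀ k, IsProbabilityMeasure (m k)] {μ : Measure (S → Bool)}
    (h : ∀ k, StochDom μ (m k)) : StochDom μ (mixture c m) := fun f hf hfm => by
  have weights : HasSum (fun k => (c k).toReal) 1 := by
    have h1 := ENNReal.hasSum_toReal (f := c) (c.tsum_coe ▸ ENNReal.one_ne_top)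
    rwa [← ENNReal.tsum_toReal_eq c.apply_ne_top, c.tsum_coe, ENNReal.toReal_one] at h1
  have constant := weights.mul_right (∫ x, f x ∂μ)
  rw [one_mul] at constant
  exact hasSum_le (fun k => mul_le_mul_of_nonneg_left (h k f hf hfm) ENNReal.toReal_nonneg)
    constant (hasSum_integral_mixture c m (integrable_comp_of_continuous _ hf measurable_id))

lemma minusNoise_mixture (ε : I) :
    minusNoise (Domination.mixture c m) ε =
      Domination.mixture c fun k => minusNoise (m k) ε := by
  rw [minusNoise_eq_map, Domination.mixture, Measure.prod_sum_left]
  simp_rw [Measure.prod_smul_left]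
  exact map_mixture c _ (by fun_prop)

end Configurations

/-- The law of a random dyadic scale `2 ^ j`, chosen with probability `2⁻¹ ^ (j + 1)`, together
with a uniform phase below it. -/
noncomputable def dyadicPhase : PMF (Σ j : ℕ, Fin (2 ^ j)) :=
  ⟨fun k => 2⁻¹ ^ (k.1 + 1) * (2 ^ k.1)⁻¹, by
    have inner (j : ℕ) : ∑' _ : Fin (2 ^ j), (2⁻¹ : ℝ≥0∞) ^ (j + 1) * (2 ^ j)⁻¹ =
        2⁻¹ ^ (j + 1) := by
      rw [tsum_fintype, Finset.sum_const, Finset.card_univ, Fintype.card_fin, nsmul_eq_mul,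
        mul_left_comm, Nat.cast_pow, Nat.cast_ofNat,
        ENNReal.mul_inv_cancel (by positivity) (by finiteness), mul_one]
    rw [ENNReal.summable.hasSum_iff, ENNReal.tsum_sigma']
    simp only [inner]
    rw [ENNReal.tsum_geometric_add_one, ENNReal.one_sub_inv_two, inv_inv,
      ENNReal.inv_mul_cancel (by norm_num) (by norm_num)]⟩

lemma toReal_dyadicPhase (k : Σ j : ℕ, Fin (2 ^ j)) :
    (dyadicPhase k).toReal = 2⁻¹ ^ (k.1 + 1) * (2 ^ k.1)⁻¹ := by
  simp [dyadicPhase, DFunLike.coe]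

lemma dyadicPhase_pos (k : Σ j : ℕ, Fin (2 ^ j)) : 0 < (dyadicPhase k).toReal := by
  rw [toReal_dyadicPhase]
  positivity

lemma translationInvariant_mixture_dyadicPhase {m : ℕ → ℕ → Measure (ℤ → Bool)}
    (hm : ∀ n k, (m n k).map (fun (x : ℤ → Bool) (i : ℤ) => x (i + 1)) = m n (k + 1))
    (hper : ∀ n, Function.Periodic (m n) n) :
    TranslationInvariant (mixture dyadicPhase fun k => m (2 ^ k.1) k.2) := by
  refine translationInvariant_of_shift_one ?_
  rw [map_mixture _ _ (measurable_shift 1)]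
  let rotate : (Σ j : ℕ, Fin (2 ^ j)) ≃ Σ j : ℕ, Fin (2 ^ j) :=
    Equiv.sigmaCongrRight fun j => Equiv.addRight 1
  refine Eq.trans ?_ (mixture_comp_equiv _ _ rotate fun _ => rfl)
  congr 1
  funext k
  have hval : ((k.2 + 1 : Fin (2 ^ k.1)) : ℕ) = (k.2 + 1) % 2 ^ k.1 := by
    simp [Fin.val_add]
  rw [hm, Function.comp_apply]
  change _ = m (2 ^ k.1) ((k.2 + 1 : Fin (2 ^ k.1)) : ℕ)
  rw [hval, (hper _).map_mod_nat]

end Mixtures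

section BlockComparison

variable {S : Type*}

lemma prodBer_mul_real_le_mul (p q : I) {A : Set (S → Bool)} (hA : MeasurableSet A)
    (hup : IsUpperSet A) :
    (prodBer S (p * q)).real A ≤ (prodBer S p).real A * (prodBer S q).real A := by
  rw [← map_inf_prodBer, map_measureReal_apply (by fun_prop) hA, ← measureReal_prod_prod]
  exact measureReal_mono fun z hz => ⟨hup inf_le_left hz, hup inf_le_right hz⟩

lemma prodBer_sq_real_le (p : I) (F : Finset S) {A : Set (S → Bool)} (hA : MeasurableSet A)
    (hup : IsUpperSet A) (hF : Disjoint A (vacant F)) :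
    (prodBer S (p * p)).real A ≤
      (1 - (1 - p * p : ℝ) ^ F.card / 2) * (prodBer S p).real A := by
  have square := prodBer_mul_real_le_mul p p hA hup
  have occupied : (prodBer S (p * p)).real A ≤ 1 - (1 - p * p : ℝ) ^ F.card := by
    rw [← Set.Icc.coe_mul, ← prodBer_real_vacant, ← probReal_compl_eq_one_sub
      (measurableSet_vacant F)]
    exact measureReal_mono hF.subset_compl_right
  have le_one : (prodBer S p).real A ≤ 1 := measureReal_le_one
  have nonneg : 0 ≤ (prodBer S p).real A := measureReal_nonneg
  have vacancy_nonneg : 0 ≤ (1 - p * p : ℝ) ^ F.card :=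
    pow_nonneg (unitInterval.one_minus_nonneg (p * p)) _
  set a := (prodBer S p).real A
  set v := (1 - p * p : ℝ) ^ F.card
  rcases le_total a (1 - v / 2) with h | h
  · nlinarith
  · nlinarith [sq_nonneg v]

lemma integral_le_mul_of_measureReal_lt_le {Ω : Type*} [MeasurableSpace Ω] {μ ν : Measure Ω}
    [IsFiniteMeasure μ] [IsFiniteMeasure ν] {g : Ω → ℝ} (hμ : Integrable g μ)
    (hν : Integrable g ν) (hg : 0 ≤ g) {c : ℝ} (hc : 0 ≤ c)
    (h : ∀ t > 0, μ.real {ω | t < g ω} ≤ c * ν.real {ω | t < g ω}) :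
    ∫ ω, g ω ∂μ ≤ c * ∫ ω, g ω ∂ν := by
  rw [← ENNReal.ofReal_le_ofReal_iff (mul_nonneg hc (integral_nonneg hg)), ENNReal.ofReal_mul hc,
    ofReal_integral_eq_lintegral_ofReal hμ (.of_forall hg),
    ofReal_integral_eq_lintegral_ofReal hν (.of_forall hg),
    lintegral_eq_lintegral_meas_lt _ (.of_forall hg) hμ.aemeasurable,
    lintegral_eq_lintegral_meas_lt _ (.of_forall hg) hν.aemeasurable,
    ← lintegral_const_mul' _ _ ENNReal.ofReal_ne_top]
  refine setLIntegral_mono' measurableSet_Ioi fun t ht => ?_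
  rw [← ofReal_measureReal, ← ofReal_measureReal, ← ENNReal.ofReal_mul hc]
  exact ENNReal.ofReal_le_ofReal (h t ht)

variable [Countable S]

lemma integral_prodBer_sq_le (p : I) (F : Finset S) {g : (S → Bool) → ℝ} (hg : Continuous g)
    (hm : Monotone g) (hF : ∀ x ∈ vacant F, g x = g ⊥) :
    ∫ x, g x ∂prodBer S (p * p) ≤ (1 - p * p : ℝ) ^ F.card / 2 * g ⊥ +
      (1 - (1 - p * p : ℝ) ^ F.card / 2) * ∫ x, g x ∂prodBer S p := by
  have hint (q : I) : Integrable g (prodBer S q) := integrable_comp_of_continuous _ hg measurable_id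
  have hsub (q : I) : Integrable (fun x => g x - g ⊥) (prodBer S q) :=
    (hint q).sub (integrable_const _)
  have vacancy_le_one : (1 - p * p : ℝ) ^ F.card ≤ 1 :=
    pow_le_one₀ (unitInterval.one_minus_nonneg (p * p)) (unitInterval.one_minus_le_one (p * p))
  have key := integral_le_mul_of_measureReal_lt_le (hsub (p * p)) (hsub p)
    (fun x => sub_nonneg.2 (hm bot_le)) (c := 1 - (1 - p * p : ℝ) ^ F.card / 2) (by linarith)
    fun t ht => prodBer_sq_real_le p F
      (measurableSet_lt measurable_const (hg.measurable.sub_const _))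
      (fun x y hxy hx => lt_of_lt_of_le hx (sub_le_sub_right (hm hxy) _))
      (Set.disjoint_left.2 fun x (hx : t < g x - g ⊥) hv => by
        rw [hF x hv, sub_self] at hx
        exact hx.not_gt ht)
  rw [integral_sub (hint _) (integrable_const _), integral_sub (hint _) (integrable_const _),
    integral_const, integral_const, probReal_univ, probReal_univ, one_smul] at key
  linarith

lemma integral_minusNoise_map_comp_prodBer {J : Type*} {b : S → J} (p q : I) {j : J}
    {f : (S → Bool) → ℝ} (hf : Continuous f) (hdep : DependsOn f (b ⁻¹' {j})) :
    ∫ x, f x ∂minusNoise ((prodBer J q).map (· ∘ b)) (σ p) =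
      q * ∫ x, f x ∂prodBer S p + (1 - q) * f ⊥ := by
  have hb : Measurable fun x : J → Bool => x ∘ b := by fun_prop
  have := Measure.isProbabilityMeasure_map (μ := prodBer J q) hb.aemeasurable
  have occupied : ∫ x, f (⊤ \ x) ∂prodBer S (σ p) = ∫ x, f x ∂prodBer S p := by
    rw [← unitInterval.symm_symm p, ← map_compl_prodBer (σ p), unitInterval.symm_symm,
      integral_map (by fun_prop) hf.measurable.aestronglyMeasurable]
    simp only [top_sdiff', hnot_eq_compl]
  have block (u : J → Bool) : ∫ x, f ((u ∘ b) \ x) ∂prodBer S (σ p) =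
      if u j then ∫ x, f x ∂prodBer S p else f ⊥ := by
    cases hu : u j
    · have (x : S → Bool) : f ((u ∘ b) \ x) = f ⊥ := hdep fun s hs => by
        simp [sdiff_eq, Set.mem_singleton_iff.1 hs, hu]
      simp [this]
    · rw [if_pos rfl, ← occupied]
      congr with x
      exact hdep fun s hs => by simp [Set.mem_singleton_iff.1 hs, hu]
  rw [minusNoise_eq_map, integral_map_prod _ _ (by fun_prop) hf, integral_map hb.aemeasurable]
  · simp only [block]
    rw [integral_eval_prodBer q j fun a => if a then ∫ x, f x ∂prodBer S p else f ⊥]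
    simp
  · exact (integrable_comp_of_continuous (((prodBer J q).map (· ∘ b)).prod (prodBer S (σ p))) hf
      (g := fun z => z.1 \ z.2) (by fun_prop)).integral_prod_left.aestronglyMeasurable

lemma prodBer_sq_stochDom_minusNoise {J : Type*} [Countable J] {b : S → J} {F : J → Finset S}
    (hF : ∀ j s, s ∈ F j ↔ b s = j) (p q : I)
    (hq : ∀ j, (1 - p * p : ℝ) ^ (F j).card / 2 = 1 - q) :
    StochDom (prodBer S (p * p)) (minusNoise ((prodBer J q).map (· ∘ b)) (σ p)) := by
  have hb : Measurable fun x : J → Bool => x ∘ b := by fun_prop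
  have := Measure.isProbabilityMeasure_map (μ := prodBer J q) hb.aemeasurable
  refine stochDom_of_block_le (b := b) (fun j => splice_prodBer_self _ _) (fun j => ?_)
    fun j f hf hm hdep => ?_
  · rw [splice_minusNoise, splice_map_comp, splice_prodBer_self]
  · have vacant_eq (x) (hx : x ∈ vacant (F j)) : f x = f ⊥ :=
      hdep fun s hs => hx s ((hF j s).2 hs)
    have h := integral_prodBer_sq_le p (F j) hf hm vacant_eq
    rw [hq, sub_sub_cancel] at h
    rw [integral_minusNoise_map_comp_prodBer p q hf hdep]
    linarith

end BlockComparison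

section BlockExample

/-- The index of the block of length `n` containing a site, where blocks start at the sites `i`
with `n ∣ i + k`. -/
def blockIndex (n k : ℕ) (i : ℤ) : ℤ := (i + k) / n

lemma map_shift_map_comp_blockIndex (μ : Measure (ℤ → Bool)) (n k : ℕ) :
    (μ.map (· ∘ blockIndex n k)).map (fun (x : ℤ → Bool) (i : ℤ) => x (i + 1)) =
      μ.map (· ∘ blockIndex n (k + 1)) := by
  rw [Measure.map_map (measurable_shift 1) (by fun_prop)]
  congr 1 with x i
  simp only [Function.comp_apply, blockIndex]
  congr 2
  push_cast
  ring

lemma periodic_map_comp_blockIndex {μ : Measure (ℤ → Bool)} (hμ : TranslationInvariant μ) (n : ℕ) :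
    Function.Periodic (fun k => μ.map (· ∘ blockIndex n k)) n := fun k => by
  rcases eq_or_ne n 0 with rfl | hn
  · rfl
  beta_reduce
  conv_rhs => rw [← hμ 1]
  rw [Measure.map_map (by fun_prop) (measurable_shift 1)]
  congr 1 with x i
  simp only [Function.comp_apply, blockIndex, Nat.cast_add]
  rw [← add_assoc, Int.add_ediv_of_dvd_right dvd_rfl, Int.ediv_self (by exact_mod_cast hn)]

lemma mem_Ico_iff_blockIndex_eq {n : ℕ} (hn : 0 < n) (k : ℕ) (j i : ℤ) :
    i ∈ Finset.Ico (j * n - k) (j * n - k + n) ↔ blockIndex n k i = j := by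
  rw [blockIndex, Finset.mem_Ico, Int.ediv_eq_iff_of_pos (by omega)]
  constructor <;> rintro ⟨h1, h2⟩ <;> constructor <;> linarith

/-- The probability with which a block of length `n` is occupied: a block is vacant half as often
as under `π_{p²}`. -/
noncomputable def blockParam (p : I) (n : ℕ) : I := σ (half * σ (p * p) ^ n)

lemma one_sub_blockParam (p : I) (n : ℕ) :
    (1 - blockParam p n : ℝ) = (1 - p * p : ℝ) ^ n / 2 := by
  simp only [blockParam, half, unitInterval.coe_symm_eq, Set.Icc.coe_mul, Set.Icc.coe_pow]
  ring

/-- The law of a configuration which is constant on the blocks of length `n` with phase `k`, the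
blocks being independently occupied with probability `blockParam p n`. -/
noncomputable def blockLaw (p : I) (n k : ℕ) : Measure (ℤ → Bool) :=
  (prodBer ℤ (blockParam p n)).map (· ∘ blockIndex n k)

instance isProbabilityMeasure_blockLaw (p : I) (n k : ℕ) :
    IsProbabilityMeasure (blockLaw p n k) :=
  Measure.isProbabilityMeasure_map (Measurable.aemeasurable (by fun_prop))

lemma prodBer_sq_stochDom_minusNoise_blockLaw (p : I) {n : ℕ} (hn : 0 < n) (k : ℕ) :
    StochDom (prodBer ℤ (p * p)) (minusNoise (blockLaw p n k) (σ p)) :=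
  prodBer_sq_stochDom_minusNoise (mem_Ico_iff_blockIndex_eq hn k) p _ fun j => by
    simp [one_sub_blockParam]

lemma pow_le_blockLaw_vacant (p : I) {n : ℕ} (hn : 0 < n) (M : ℕ) :
    ((1 - p * p : ℝ) ^ n / 2) ^ M ≤
      (blockLaw p n 0).real (vacant (Finset.Ico (0 : ℤ) (n * M : ℕ))) := by
  have blocks := prodBer_real_vacant (blockParam p n) (Finset.Ico (0 : ℤ) M)
  rw [one_sub_blockParam, Int.card_Ico, sub_zero, Int.toNat_natCast] at blocks
  rw [← blocks, blockLaw, map_measureReal_apply (by fun_prop) (measurableSet_vacant _)]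
  refine measureReal_mono fun x hx i hi => hx _ ?_
  have hn' : (0 : ℤ) < n := by omega
  simp only [Finset.mem_Ico, blockIndex] at hi ⊢
  push_cast at hi ⊢
  rw [add_zero]
  exact ⟨Int.ediv_nonneg hi.1 hn'.le, Int.ediv_lt_of_lt_mul hn' (by linarith)⟩

/-- The mixture of the block laws over a random dyadic block length and a uniform phase. -/
noncomputable def blockMixture (p : I) : Measure (ℤ → Bool) :=
  mixture dyadicPhase fun k => blockLaw p (2 ^ k.1) k.2

instance isProbabilityMeasure_blockMixture (p : I) : IsProbabilityMeasure (blockMixture p) := by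
  unfold blockMixture
  infer_instance

lemma blockMixture_translationInvariant (p : I) : TranslationInvariant (blockMixture p) :=
  translationInvariant_mixture_dyadicPhase (fun _ _ => map_shift_map_comp_blockIndex _ _ _)
    fun _ => periodic_map_comp_blockIndex (fun k => map_shift_prodBer _ k) _

lemma prodBer_sq_stochDom_minusNoise_blockMixture (p : I) :
    StochDom (prodBer ℤ (p * p)) (minusNoise (blockMixture p) (σ p)) := by
  rw [blockMixture, minusNoise_mixture]
  exact StochDom.mixture _ fun k => prodBer_sq_stochDom_minusNoise_blockLaw p (by positivity) _

lemma prodBer_sq_stochDom_blockMixture (p : I) : StochDom (prodBer ℤ (p * p)) (blockMixture p) :=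
  (prodBer_sq_stochDom_minusNoise_blockMixture p).trans (minusNoise_stochDom _ _)

lemma blockMixture_dominatesProduct {p : I} (hp : 0 < p) : DominatesProduct (blockMixture p) :=
  ⟨p * p, mul_pos hp hp, prodBer_sq_stochDom_blockMixture p⟩

lemma pMax_blockMixture_le (p : I) : pMax (blockMixture p) ≤ p * p := sSup_le fun q hq => by
  have hq0 : (0 : ℝ) ≤ 1 - q := unitInterval.one_minus_nonneg q
  have block (j : ℕ) : (1 - p * p : ℝ) ^ 2 ^ j / 2 ≤ (1 - q : ℝ) ^ 2 ^ j := by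
    refine le_of_frequently_mul_pow_le (dyadicPhase_pos ⟨j, 0⟩) (by positivity)
      (.of_forall fun M => ?_)
    have vacancies := StochDom.vacant_le hq (Finset.Ico (0 : ℤ) (2 ^ j * M : ℕ))
    rw [prodBer_real_vacant, Int.card_Ico, sub_zero, Int.toNat_natCast, pow_mul] at vacancies
    refine le_trans ?_ vacancies
    refine le_trans ?_ (mul_measureReal_le_mixture _ _ ⟨j, 0⟩ _)
    exact mul_le_mul_of_nonneg_left (pow_le_blockLaw_vacant p (by positivity) M)
      (dyadicPhase_pos _).le
  have h : (1 - p * p : ℝ) ≤ 1 - q := by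
    refine le_of_frequently_mul_pow_le (c := 1 / 2) (by norm_num) hq0
      (frequently_atTop.2 fun N => ⟨2 ^ N, Nat.lt_two_pow_self.le, ?_⟩)
    linarith [block N]
  exact Subtype.coe_le_coe.1 (by rw [Set.Icc.coe_mul]; linarith)

lemma blockMixture_not_rigid {p : I} (hp0 : 0 < p) (hp1 : p < 1) : ¬ Rigid (blockMixture p) :=
  have below := prodBer_mono (S := ℤ) (pMax_blockMixture_le p)
  fun h => h ⟨below.trans (prodBer_sq_stochDom_blockMixture p), σ p,
    by simpa using unitInterval.symm_lt_symm.2 hp1, by simpa using unitInterval.symm_lt_symm.2 hp0,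
    below.trans (prodBer_sq_stochDom_minusNoise_blockMixture p)⟩

end BlockExample

section BitFlips

section Update

variable {ι : Type*} [DecidableEq ι] {X : ι → Type*} [∀ i, MeasurableSpace (X i)]
  (μ : ∀ i, Measure (X i)) [∀ i, IsProbabilityMeasure (μ i)]

lemma map_update_prod_infinitePi (j : ι) :
    ((Measure.infinitePi μ).prod (μ j)).map (fun z => Function.update z.1 j z.2) =
      Measure.infinitePi μ := by
  have resample := map_piecewise_infinitePi μ {j}ᶜ
  have update_eq (z : (∀ i, X i) × ∀ i, X i) :
      ({j}ᶜ : Set ι).piecewise z.1 z.2 = Function.update z.1 j (z.2 j) := by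
    ext i
    rcases eq_or_ne i j with rfl | hi
    · simp
    · simp [hi]
  simp_rw [update_eq] at resample
  conv_rhs => rw [← resample]
  rw [← Measure.infinitePi_map_eval μ j]
  nth_rw 1 [← Measure.map_id (μ := Measure.infinitePi μ)]
  rw [Measure.map_prod_map _ _ measurable_id (measurable_pi_apply j),
    Measure.map_map (by fun_prop) (by fun_prop)]
  rfl

lemma map_update_infinitePi_le (j : ι) {φ : X j → X j} (hφ : Measurable φ) {K : ℝ≥0}
    (h : (μ j).map φ ≤ K • μ j) :
    (Measure.infinitePi μ).map (fun x => Function.update x j (φ (x j))) ≤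
      K • Measure.infinitePi μ := by
  have : IsProbabilityMeasure ((μ j).map φ) := Measure.isProbabilityMeasure_map hφ.aemeasurable
  calc (Measure.infinitePi μ).map (fun x => Function.update x j (φ (x j)))
      = ((Measure.infinitePi μ).prod ((μ j).map φ)).map fun z => Function.update z.1 j z.2 := by
        nth_rw 1 [← map_update_prod_infinitePi μ j]
        nth_rw 2 [← Measure.map_id (μ := Measure.infinitePi μ)]
        rw [Measure.map_map (by fun_prop) (by fun_prop),
          Measure.map_prod_map _ _ measurable_id hφ,
          Measure.map_map (by fun_prop) (by fun_prop)]
        congr 1 with z : 1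
        simp
    _ ≤ ((Measure.infinitePi μ).prod (K • μ j)).map fun z => Function.update z.1 j z.2 :=
        Measure.map_mono (Measure.prod_mono le_rfl h) (by fun_prop)
    _ = K • Measure.infinitePi μ := by
        rw [Measure.prod_smul_right, Measure.map_smul, map_update_prod_infinitePi]

end Update

variable {ι : Type*}

/-- The law of independent bits, the bit at `i` being occupied with probability `p i`. -/
noncomputable def bits (p : ι → I) : Measure (ι → Bool) :=
  Measure.infinitePi fun i => bernoulliMeasure true false (p i)

instance isProbabilityMeasure_bits (p : ι → I) : IsProbabilityMeasure (bits p) :=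
  inferInstanceAs (IsProbabilityMeasure (Measure.infinitePi _))

variable [DecidableEq ι]

/-- The configuration obtained from `x` by changing its value at `s`. -/
def flipAt (s : ι) (x : ι → Bool) : ι → Bool := Function.update x s (!x s)

@[fun_prop]
lemma measurable_flipAt (s : ι) : Measurable (flipAt s) := by
  unfold flipAt
  fun_prop

lemma map_not_bernoulliMeasure_le {p : I} (h₁ : (1 / 4 : ℝ) ≤ p) (h₂ : (p : ℝ) ≤ 3 / 4) :
    (bernoulliMeasure true false p).map (!·) ≤ (3 : ℝ≥0) • bernoulliMeasure true false p := by
  rw [map_not_bernoulliMeasure, bernoulliMeasure_def, bernoulliMeasure_def, unitInterval.symm_symm,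
    smul_add, smul_smul, smul_smul]
  refine Measure.le_iff'.2 fun A => add_le_add ?_ ?_ <;>
    refine mul_le_mul_left (ENNReal.coe_le_coe.2 (NNReal.coe_le_coe.1 ?_)) _
  · change (1 - p : ℝ) ≤ 3 * p
    linarith
  · change (p : ℝ) ≤ 3 * (1 - p)
    linarith

lemma map_flipAt_bits_le {p : ι → I} {s : ι} (h₁ : (1 / 4 : ℝ) ≤ p s) (h₂ : (p s : ℝ) ≤ 3 / 4) :
    (bits p).map (flipAt s) ≤ (3 : ℝ≥0) • bits p :=
  map_update_infinitePi_le _ s measurable_from_top (map_not_bernoulliMeasure_le h₁ h₂)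

lemma mem_flipAt_iff {s : ι} {A : Set (ι → Bool)} (hA : MeasurableSet[cylinderEvents {s}ᶜ] A)
    (x : ι → Bool) : flipAt s x ∈ A ↔ x ∈ A := by
  have invariant : cylinderEvents {s}ᶜ ≤ MeasurableSpace.invariants (flipAt s) := by
    refine iSup₂_le fun t ht => ?_
    rintro _ ⟨B, hB, rfl⟩
    refine MeasurableSpace.measurableSet_invariants.2 ⟨measurable_pi_apply t hB, ?_⟩
    ext x
    rw [Set.mem_preimage, Set.mem_preimage, flipAt, Function.update_of_ne ht, Set.mem_preimage]
  exact Set.ext_iff.1 (MeasurableSpace.measurableSet_invariants.1 (invariant _ hA)).2 x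

lemma insertionTolerant_of_map_flipAt_le {μ : Measure (ι → Bool)} [IsProbabilityMeasure μ]
    {K : ℝ≥0} (h : ∀ s, μ.map (flipAt s) ≤ K • μ) : InsertionTolerant μ (1 + K)⁻¹ := by
  refine insertionTolerant_of_forall_measureReal_le fun s A hA => ?_
  have hAE : MeasurableSet (A ∩ {x | x s = true}) :=
    (cylinderEvents_le_pi _ hA).inter (measurableSet_occupied s)
  have cover : A ⊆ (A ∩ {x | x s = true}) ∪ flipAt s ⁻¹' (A ∩ {x | x s = true}) := by
    intro x hx
    by_cases hs : x s = true
    · exact .inl ⟨hx, hs⟩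
    · exact .inr ⟨(mem_flipAt_iff hA x).2 hx, by simpa [flipAt] using hs⟩
  have flipped : μ.real (flipAt s ⁻¹' (A ∩ {x | x s = true})) ≤
      K * μ.real (A ∩ {x | x s = true}) := by
    rw [← map_measureReal_apply (measurable_flipAt s) hAE, ← measureReal_nnreal_smul_apply]
    exact ENNReal.toReal_mono (by finiteness) (h s _)
  rw [inv_mul_le_iff₀ (by positivity), add_mul, one_mul]
  exact ((measureReal_mono cover).trans (measureReal_union_le _ _)).trans (by gcongr)

lemma map_flipAt_map_le {Ω : Type*} [MeasurableSpace Ω] {P : Measure Ω} {Φ : Ω → ι → Bool}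
    (hΦ : Measurable Φ) {T : Ω → Ω} (hT : Measurable T) {K : ℝ≥0} (hP : P.map T ≤ K • P) {s : ι}
    (h : ∀ u, Φ (T u) = flipAt s (Φ u)) : (P.map Φ).map (flipAt s) ≤ K • P.map Φ := by
  have : flipAt s ∘ Φ = Φ ∘ T := funext fun u => (h u).symm
  rw [Measure.map_map (by fun_prop) hΦ, this, ← Measure.map_map hΦ hT, ← Measure.map_smul]
  exact Measure.map_mono hP hΦ

end BitFlips

section Parity

/-- The spin of a bit: `-1` for an occupied site and `1` for a vacant one. -/
def sgn (b : Bool) : ℝ := if b then -1 else 1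

lemma sgn_not (b : Bool) : sgn (!b) = -sgn b := by cases b <;> simp [sgn]

lemma sgn_mul_self (b : Bool) : sgn b * sgn b = 1 := by cases b <;> simp [sgn]

lemma abs_sgn (b : Bool) : |sgn b| = 1 := by cases b <;> simp [sgn]

lemma sgn_injective : Function.Injective sgn := by
  intro a b h
  cases a <;> cases b <;> first | rfl | norm_num [sgn] at h

variable {ι : Type*}

lemma measurable_prod_sgn (R : Finset ι) : Measurable fun x : ι → Bool => ∏ i ∈ R, sgn (x i) :=
  Finset.measurable_fun_prod R fun i _ =>
    (measurable_from_top (f := sgn)).comp (measurable_pi_apply i)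

lemma abs_prod_sgn (R : Finset ι) (x : ι → Bool) : |∏ i ∈ R, sgn (x i)| = 1 := by
  simp only [Finset.abs_prod, abs_sgn, Finset.prod_const_one]

lemma integrable_prod_sgn (R : Finset ι) (μ : Measure (ι → Bool)) [IsFiniteMeasure μ] :
    Integrable (fun x => ∏ i ∈ R, sgn (x i)) μ :=
  .of_bound (measurable_prod_sgn R).aestronglyMeasurable 1
    (.of_forall fun x => (abs_prod_sgn R x).le)

lemma prod_sgn_eq_neg_one_pow (R : Finset ι) (x : ι → Bool) :
    ∏ i ∈ R, sgn (x i) = (-1) ^ (R.filter fun i => x i = true).card := by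
  simp only [sgn, Finset.prod_ite, Finset.prod_const, one_pow, mul_one]

/-- The configuration whose value at `i` is the parity of the number of occupied sites of `u` in
`B i`. -/
def parityField (B : ι → Finset ι) (u : ι → Bool) (i : ι) : Bool :=
  decide (Odd ((B i).filter fun j => u j = true).card)

lemma sgn_parityField (B : ι → Finset ι) (u : ι → Bool) (i : ι) :
    sgn (parityField B u i) = ∏ j ∈ B i, sgn (u j) := by
  rw [prod_sgn_eq_neg_one_pow, parityField, sgn]
  rcases Nat.even_or_odd ((B i).filter fun j => u j = true).card with h | h
  · simp [h.neg_one_pow, h]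
  · simp [h.neg_one_pow, h]

@[fun_prop]
lemma measurable_parityField (B : ι → Finset ι) : Measurable (parityField B) :=
  measurable_pi_lambda _ fun i => by
    simp only [parityField, Finset.card_filter]
    exact (measurable_from_top (f := fun n : ℕ => decide (Odd n))).comp
      (Finset.measurable_fun_sum _ fun j _ =>
        (measurable_from_top (f := fun b : Bool => if b = true then 1 else 0)).comp
          (measurable_pi_apply j))

lemma prod_sgn_parityField [DecidableEq ι] (B : ι → Finset ι) (R : Finset ι) (u : ι → Bool) :
    ∏ i ∈ R, sgn (parityField B u i) =
      ∏ j ∈ R.biUnion B, sgn (u j) ^ (R.filter fun i => j ∈ B i).card := by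
  have extend (i : ι) (hi : i ∈ R) : sgn (parityField B u i) =
      ∏ j ∈ R.biUnion B, if j ∈ B i then sgn (u j) else 1 := by
    rw [sgn_parityField, Finset.prod_ite_mem,
      Finset.inter_eq_right.2 (Finset.subset_biUnion_of_mem B hi)]
  rw [Finset.prod_congr rfl extend, Finset.prod_comm]
  simp only [Finset.prod_ite, Finset.prod_const, one_pow, mul_one]

/-- The first Griffiths inequality: a moment of independent spins with nonnegative means. -/
lemma integral_prod_sgn_parityField_nonneg {p : ι → I} (hp : ∀ i, (p i : ℝ) ≤ 1 / 2)
    (B : ι → Finset ι) (R : Finset ι) :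
    0 ≤ ∫ x, ∏ i ∈ R, sgn (x i) ∂(bits p).map (parityField B) := by
  classical
  rw [integral_map (by fun_prop) (measurable_prod_sgn R).aestronglyMeasurable]
  simp_rw [prod_sgn_parityField]
  rw [bits, integral_finsetProd_infinitePi _ _
    (φ := fun j b => sgn b ^ (R.filter fun i => j ∈ B i).card) fun _ => measurable_of_countable _]
  refine Finset.prod_nonneg fun j _ => ?_
  rw [integral_bernoulliMeasure_true_false]
  have hj := hp j
  rcases Nat.even_or_odd (R.filter fun i => j ∈ B i).card with h | h
  · simp [sgn, h.neg_one_pow]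
  · simp only [sgn, if_true, Bool.false_eq_true, if_false, h.neg_one_pow, one_pow]
    linarith

variable [DecidableEq ι]

lemma sgn_flipAt (s : ι) (x : ι → Bool) (i : ι) :
    sgn (flipAt s x i) = (if i = s then -1 else 1) * sgn (x i) := by
  rcases eq_or_ne i s with rfl | hi
  · simp [flipAt, sgn_not]
  · simp [flipAt, hi]

lemma sgn_parityField_flipAt (B : ι → Finset ι) (s : ι) (u : ι → Bool) (i : ι) :
    sgn (parityField B (flipAt s u) i) =
      (if s ∈ B i then -1 else 1) * sgn (parityField B u i) := by
  simp_rw [sgn_parityField, sgn_flipAt, Finset.prod_mul_distrib, Finset.prod_ite_eq']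

end Parity

section BlockParity

variable {ι : Type*} [DecidableEq ι] (r : ι → ι) (F : ι → Finset ι)

/-- For a partition into blocks `F t` indexed by their representatives `t = r t`, the configuration
which carries at each representative the parity of `u` on its block, and agrees with `u`
elsewhere. -/
def blockParityField (u : ι → Bool) : ι → Bool :=
  parityField (fun i => if r i = i then F i else {i}) u

/-- The law of a configuration that is uniform on each block up to a bias of the parity: the
number of occupied sites of a block is odd with probability `1 / 4`. -/
noncomputable def parityLaw : Measure (ι → Bool) :=
  (bits fun i => if r i = i then half * half else half).map (blockParityField r F)

@[fun_prop]
lemma measurable_blockParityField : Measurable (blockParityField r F) :=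
  measurable_parityField _

instance isProbabilityMeasure_parityLaw : IsProbabilityMeasure (parityLaw r F) :=
  Measure.isProbabilityMeasure_map (Measurable.aemeasurable (by fun_prop))

lemma parityLaw_param_mem (i : ι) :
    ((if r i = i then half * half else half : I) : ℝ) ∈ Set.Icc (1 / 4 : ℝ) (1 / 2) := by
  split_ifs <;> norm_num [half]

variable {F}

lemma integral_prod_sgn_parityLaw_nonneg (R : Finset ι) :
    0 ≤ ∫ x, ∏ i ∈ R, sgn (x i) ∂parityLaw r F :=
  integral_prod_sgn_parityField_nonneg (fun i => (parityLaw_param_mem r i).2) _ R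

variable {r} (hF : ∀ s t, r t = t → (s ∈ F t ↔ r s = t))
include hF

lemma blockParityField_flipAt {s : ι} (hs : r s = s) (u : ι → Bool) :
    blockParityField r F (flipAt s u) = flipAt s (blockParityField r F u) := by
  funext i
  refine sgn_injective ?_
  rw [blockParityField, sgn_parityField_flipAt, sgn_flipAt, blockParityField]
  congr 2
  grind

lemma blockParityField_flipAt_flipAt (hr : ∀ s, r (r s) = r s) {s : ι} (hs : r s ≠ s)
    (u : ι → Bool) :
    blockParityField r F (flipAt s (flipAt (r s) u)) = flipAt s (blockParityField r F u) := by
  funext i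
  refine sgn_injective ?_
  rw [blockParityField, sgn_parityField_flipAt, sgn_parityField_flipAt, sgn_flipAt,
    blockParityField, ← mul_assoc]
  congr 1
  grind

lemma map_flipAt_parityLaw_le (hr : ∀ s, r (r s) = r s) (s : ι) :
    (parityLaw r F).map (flipAt s) ≤ (9 : ℝ≥0) • parityLaw r F := by
  let P : Measure (ι → Bool) := bits fun i => if r i = i then half * half else half
  have flip (t : ι) : P.map (flipAt t) ≤ (3 : ℝ≥0) • P :=
    map_flipAt_bits_le (parityLaw_param_mem r t).1
      ((parityLaw_param_mem r t).2.trans (by norm_num))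
  have flip_flip : P.map (flipAt s ∘ flipAt (r s)) ≤ (9 : ℝ≥0) • P := by
    rw [← Measure.map_map (by fun_prop) (by fun_prop)]
    calc (P.map (flipAt (r s))).map (flipAt s) ≤ ((3 : ℝ≥0) • P).map (flipAt s) :=
          Measure.map_mono (flip _) (by fun_prop)
      _ ≤ (3 : ℝ≥0) • (3 : ℝ≥0) • P := by
          rw [Measure.map_smul]
          exact smul_le_smul_left _ (flip s)
      _ = (9 : ℝ≥0) • P := by rw [smul_smul]; norm_num
  by_cases hs : r s = s
  · refine map_flipAt_map_le (by fun_prop) (measurable_flipAt s) ((flip s).trans ?_)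
      (blockParityField_flipAt hF hs)
    exact Measure.le_iff'.2 fun A => mul_le_mul_left (by norm_num) _
  · exact map_flipAt_map_le (by fun_prop) (by fun_prop) flip_flip
      (blockParityField_flipAt_flipAt hF hr hs)

lemma prod_sgn_blockParityField {t : ι} (ht : r t = t) (u : ι → Bool) :
    ∏ i ∈ F t, sgn (blockParityField r F u i) = sgn (u t) := by
  have mem : t ∈ F t := (hF t t ht).2 ht
  have other (i : ι) (hi : i ∈ (F t).erase t) : sgn (blockParityField r F u i) = sgn (u i) := by
    have : r i ≠ i := by grind
    rw [blockParityField, sgn_parityField, if_neg this, Finset.prod_singleton]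
  rw [← Finset.mul_prod_erase _ _ mem, Finset.prod_congr rfl other, blockParityField,
    sgn_parityField, if_pos ht, ← Finset.mul_prod_erase _ _ mem, mul_assoc,
    ← Finset.prod_mul_distrib]
  simp only [sgn_mul_self, Finset.prod_const_one, mul_one]

lemma integral_prod_sgn_parityLaw_block {t : ι} (ht : r t = t) :
    ∫ x, ∏ i ∈ F t, sgn (x i) ∂parityLaw r F = 1 / 2 := by
  rw [parityLaw, integral_map (by fun_prop) (measurable_prod_sgn _).aestronglyMeasurable]
  simp_rw [prod_sgn_blockParityField hF ht]
  have expectation := integral_finsetProd_infinitePi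
    (fun i => bernoulliMeasure true false (if r i = i then half * half else half)) {t}
    (φ := fun _ => sgn) fun _ => measurable_of_countable _
  simp only [Finset.prod_singleton, if_pos ht, integral_bernoulliMeasure_true_false] at expectation
  rw [bits, expectation]
  norm_num [sgn, half]

end BlockParity

section Extractability

variable {S : Type*} [Countable S]

lemma integral_prod_sgn_add_plusNoise (ν : Measure (S → Bool)) [IsFiniteMeasure ν] (ε : I)
    (T : Finset S) : ∫ x, ∏ i ∈ T, (sgn (x i) + ε) ∂plusNoise ν ε =
      (1 - ε : ℝ) ^ T.card * ∫ x, ∏ i ∈ T, sgn (x i) ∂ν := by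
  have cont : Continuous fun x : S → Bool => ∏ i ∈ T, (sgn (x i) + (ε : ℝ)) :=
    continuous_finsetProd T fun i _ =>
      ((continuous_of_discreteTopology (f := sgn)).comp (continuous_apply i)).add continuous_const
  have noise (x : S → Bool) :
      ∫ y, ∏ i ∈ T, (sgn (x i || y i) + ε) ∂prodBer S ε =
        (1 - ε : ℝ) ^ T.card * ∏ i ∈ T, sgn (x i) := by
    rw [prodBer, integral_finsetProd_infinitePi _ T (φ := fun i b => sgn (x i || b) + (ε : ℝ))
      fun _ => measurable_of_countable _, ← Finset.prod_const, ← Finset.prod_mul_distrib]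
    refine Finset.prod_congr rfl fun i _ => ?_
    rw [integral_bernoulliMeasure_true_false]
    cases x i <;> simp only [sgn, Bool.or_true, Bool.or_false, if_true, if_false,
      Bool.false_eq_true] <;> ring
  rw [plusNoise_eq_map, integral_map_prod _ _ (by fun_prop) cont, ← integral_const_mul]
  exact integral_congr_ae (.of_forall noise)

lemma UpwardsExtractable.integral_prod_sgn_le {μ : Measure (S → Bool)} [IsFiniteMeasure μ] {ε : I}
    (h : UpwardsExtractable μ ε) (hμ : ∀ R : Finset S, 0 ≤ ∫ x, ∏ i ∈ R, sgn (x i) ∂μ)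
    (T : Finset S) : ∫ x, ∏ i ∈ T, sgn (x i) ∂μ ≤ (1 - ε : ℝ) ^ T.card := by
  classical
  obtain ⟨ν, hν, rfl⟩ := h
  have expansion : ∫ x, ∏ i ∈ T, (sgn (x i) + ε) ∂plusNoise ν ε =
      ∑ R ∈ T.powerset, (∫ x, ∏ i ∈ R, sgn (x i) ∂plusNoise ν ε) * ε ^ (T \ R).card := by
    simp_rw [Finset.prod_add, Finset.prod_const]
    rw [integral_finsetSum _ fun R _ => (integrable_prod_sgn R _).mul_const _]
    simp_rw [integral_mul_const]
  calc ∫ x, ∏ i ∈ T, sgn (x i) ∂plusNoise ν ε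
      = (∫ x, ∏ i ∈ T, sgn (x i) ∂plusNoise ν ε) * ε ^ (T \ T).card := by simp
    _ ≤ ∑ R ∈ T.powerset, (∫ x, ∏ i ∈ R, sgn (x i) ∂plusNoise ν ε) * ε ^ (T \ R).card :=
        Finset.single_le_sum
          (f := fun R => (∫ x, ∏ i ∈ R, sgn (x i) ∂plusNoise ν ε) * (ε : ℝ) ^ (T \ R).card)
          (fun R _ => mul_nonneg (hμ R) (pow_nonneg ε.2.1 _)) (Finset.mem_powerset_self T)
    _ = (1 - ε : ℝ) ^ T.card * ∫ x, ∏ i ∈ T, sgn (x i) ∂ν := by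
        rw [← expansion, integral_prod_sgn_add_plusNoise]
    _ ≤ (1 - ε : ℝ) ^ T.card * ∫ _, 1 ∂ν := by
        refine mul_le_mul_of_nonneg_left ?_ (pow_nonneg (unitInterval.one_minus_nonneg ε) _)
        exact integral_mono (integrable_prod_sgn T ν) (integrable_const 1) fun x =>
          (le_abs_self _).trans (abs_prod_sgn T x).le
    _ = (1 - ε : ℝ) ^ T.card := by simp

end Extractability

section ParityExample

/-- The first site of the block containing `i`, for the partition of `ℤ` into blocks of length `n`
that start at the sites `t` with `n ∣ t + k`. -/
def blockStart (n k : ℕ) (i : ℤ) : ℤ := i - (i + k) % n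

lemma blockStart_blockStart (n k : ℕ) (i : ℤ) :
    blockStart n k (blockStart n k i) = blockStart n k i := by
  have dvd : (n : ℤ) ∣ blockStart n k i + k := by
    have : blockStart n k i + k = i + k - (i + k) % n := by rw [blockStart]; ring
    exact this ▸ Int.dvd_self_sub_emod
  conv_lhs => rw [blockStart, Int.emod_eq_zero_of_dvd dvd, sub_zero]

lemma mem_Ico_iff_blockStart_eq {n : ℕ} (hn : 0 < n) (k : ℕ) (s t : ℤ)
    (ht : blockStart n k t = t) : s ∈ Finset.Ico t (t + n) ↔ blockStart n k s = t := by
  have dvd : (n : ℤ) ∣ t + k := Int.dvd_of_emod_eq_zero (by rw [blockStart] at ht; linarith)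
  rw [blockStart, sub_eq_iff_eq_add, eq_comm, ← eq_sub_iff_add_eq', Int.emod_eq_iff (by lia),
    Finset.mem_Ico]
  have : s - t - (s + k) = -(t + k) := by ring
  simp only [this, dvd_neg, dvd, and_true]
  lia

lemma blockStart_add_one (n k : ℕ) (i : ℤ) :
    blockStart n k (i + 1) = blockStart n (k + 1) i + 1 := by
  simp only [blockStart, Nat.cast_add, Nat.cast_one]
  ring_nf

lemma periodic_blockStart (n : ℕ) : Function.Periodic (blockStart n) n := fun k => by
  funext i
  simp only [blockStart, Nat.cast_add, ← add_assoc, Int.add_emod_right]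

/-- The parity law for the blocks of length `n` with phase `k`. -/
noncomputable def intervalParityLaw (n k : ℕ) : Measure (ℤ → Bool) :=
  parityLaw (blockStart n k) fun t => Finset.Ico t (t + n)

instance isProbabilityMeasure_intervalParityLaw (n k : ℕ) :
    IsProbabilityMeasure (intervalParityLaw n k) := isProbabilityMeasure_parityLaw _ _

lemma map_shift_intervalParityLaw (n k : ℕ) :
    (intervalParityLaw n k).map (fun (x : ℤ → Bool) (i : ℤ) => x (i + 1)) =
      intervalParityLaw n (k + 1) := by
  let p (k : ℕ) (i : ℤ) : I := if blockStart n k i = i then half * half else half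
  have fixed (i : ℤ) : blockStart n k (i + 1) = i + 1 ↔ blockStart n (k + 1) i = i := by
    rw [blockStart_add_one, add_left_inj]
  have shift_bits : (bits (p k)).map (fun (x : ℤ → Bool) (i : ℤ) => x (i + 1)) =
      bits (p (k + 1)) := by
    rw [bits, Measure.map_infinitePi_infinitePi_of_inj (f := fun i : ℤ => i + 1)
      (add_left_injective 1), bits]
    simp only [p, fixed]
  change ((bits (p k)).map _).map _ = (bits (p (k + 1))).map _
  rw [Measure.map_map (measurable_shift 1) (by fun_prop), ← shift_bits,
    Measure.map_map (by fun_prop) (measurable_shift 1)]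
  congr 1
  funext u i
  refine sgn_injective ?_
  simp only [Function.comp_apply, blockParityField, sgn_parityField, fixed]
  split_ifs
  · rw [add_right_comm, ← Finset.map_add_right_Ico, Finset.prod_map]
    rfl
  · simp only [Finset.prod_singleton]

/-- The mixture of the parity laws over a random dyadic block length and a uniform phase. -/
noncomputable def parityMixture : Measure (ℤ → Bool) :=
  mixture dyadicPhase fun k => intervalParityLaw (2 ^ k.1) k.2

instance isProbabilityMeasure_parityMixture : IsProbabilityMeasure parityMixture :=
  isProbabilityMeasure_mixture _ _

lemma parityMixture_translationInvariant : TranslationInvariant parityMixture :=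
  translationInvariant_mixture_dyadicPhase map_shift_intervalParityLaw fun n k => by
    rw [intervalParityLaw, periodic_blockStart, intervalParityLaw]

lemma parityMixture_uniformlyInsertionTolerant : UniformlyInsertionTolerant parityMixture := by
  refine ⟨_, by positivity, insertionTolerant_of_map_flipAt_le (K := 9) fun s => ?_⟩
  rw [parityMixture, map_mixture _ _ (measurable_flipAt s)]
  exact mixture_le_smul _ fun k => map_flipAt_parityLaw_le
    (mem_Ico_iff_blockStart_eq (by positivity) _) (blockStart_blockStart _ _) s

lemma integral_prod_sgn_parityMixture_nonneg (R : Finset ℤ) :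
    0 ≤ ∫ x, ∏ i ∈ R, sgn (x i) ∂parityMixture :=
  integral_mixture_nonneg _ _ (integrable_prod_sgn R _) fun _ =>
    integral_prod_sgn_parityLaw_nonneg _ R

lemma le_integral_prod_sgn_parityMixture (j : ℕ) :
    2⁻¹ ^ (j + 1) * (2 ^ j)⁻¹ * (1 / 2) ≤
      ∫ x, ∏ i ∈ Finset.Ico (0 : ℤ) (2 ^ j : ℕ), sgn (x i) ∂parityMixture := by
  have start : blockStart (2 ^ j) 0 0 = 0 := by simp [blockStart]
  have block : ∫ x, ∏ i ∈ Finset.Ico (0 : ℤ) (2 ^ j : ℕ), sgn (x i) ∂intervalParityLaw (2 ^ j) 0 =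
      1 / 2 := by
    have h := integral_prod_sgn_parityLaw_block (F := fun t : ℤ => Finset.Ico t (t + (2 ^ j : ℕ)))
      (mem_Ico_iff_blockStart_eq (n := 2 ^ j) (by positivity) 0) start
    rwa [zero_add] at h
  rw [← toReal_dyadicPhase ⟨j, 0⟩, ← block]
  exact mul_le_integral_mixture dyadicPhase (fun k => intervalParityLaw (2 ^ k.1) k.2)
    (integrable_prod_sgn _ parityMixture)
    (fun _ => integral_prod_sgn_parityLaw_nonneg _ _) ⟨j, 0⟩

lemma parityMixture_not_uniformlyUpwardsExtractable :
    ¬ UniformlyUpwardsExtractable parityMixture := by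
  rintro ⟨ε, h0, h1, h⟩
  have h0' : (0 : ℝ) < ε := h0
  have h1' : (ε : ℝ) < 1 := h1
  have bound (j : ℕ) : 1 / 4 ≤ ((2 ^ j : ℕ) : ℝ) ^ 2 * (1 - ε : ℝ) ^ 2 ^ j := by
    have := (le_integral_prod_sgn_parityMixture j).trans
      (h.integral_prod_sgn_le integral_prod_sgn_parityMixture_nonneg _)
    rw [Int.card_Ico, sub_zero, Int.toNat_natCast, inv_pow, pow_succ] at this
    push_cast
    field_simp at this
    linarith
  have decay := (tendsto_pow_const_mul_const_pow_of_abs_lt_one 2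
    (r := (1 - ε : ℝ)) (abs_lt.2 ⟨by linarith, by linarith⟩)).comp
    (tendsto_pow_atTop_atTop_of_one_lt (α := ℕ) (r := 2) one_lt_two)
  have := ge_of_tendsto' decay bound
  norm_num at this

end ParityExample

end Domination

theorem theorem1p5 :
    -- the implications, for every nonempty countable set of sites
    (∀ (S : Type*) [Countable S] [Nonempty S] (μ : Measure (S → Bool)) [IsProbabilityMeasure μ],
      (Domination.UniformlyUpwardsExtractable μ → Domination.UniformlyInsertionTolerant μ) ∧
      (Domination.UniformlyInsertionTolerant μ → Domination.DominatesProduct μ) ∧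
      (Domination.UniformlyUpwardsExtractable μ → Domination.Rigid μ) ∧
      (Domination.Rigid μ → Domination.DominatesProduct μ)) ∧
    -- uniform insertion tolerance does not imply uniform upwards extractability
    (∃ μ : Measure (ℤ → Bool), IsProbabilityMeasure μ ∧ Domination.TranslationInvariant μ ∧
      Domination.UniformlyInsertionTolerant μ ∧ ¬ Domination.UniformlyUpwardsExtractable μ) ∧
    -- domination of a nontrivial product measure does not imply uniform insertion tolerance
    (∃ μ : Measure (ℤ → Bool), IsProbabilityMeasure μ ∧ Domination.TranslationInvariant μ ∧
      Domination.DominatesProduct μ ∧ ¬ Domination.UniformlyInsertionTolerant μ) ∧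
    -- rigidity does not imply uniform upwards extractability
    (∃ μ : Measure (ℤ → Bool), IsProbabilityMeasure μ ∧ Domination.TranslationInvariant μ ∧
      Domination.Rigid μ ∧ ¬ Domination.UniformlyUpwardsExtractable μ) ∧
    -- domination of a nontrivial product measure does not imply rigidity
    (∃ μ : Measure (ℤ → Bool), IsProbabilityMeasure μ ∧ Domination.TranslationInvariant μ ∧
      Domination.DominatesProduct μ ∧ ¬ Domination.Rigid μ) ∧
    -- rigidity does not imply uniform insertion tolerance
    (∃ μ : Measure (ℤ → Bool), IsProbabilityMeasure μ ∧ Domination.TranslationInvariant μ ∧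
      Domination.Rigid μ ∧ ¬ Domination.UniformlyInsertionTolerant μ) := by
  open Domination in
  exact ⟨fun S _ _ μ _ => ⟨UniformlyUpwardsExtractable.uniformlyInsertionTolerant,
      UniformlyInsertionTolerant.dominatesProduct, UniformlyUpwardsExtractable.rigid,
      Rigid.dominatesProduct⟩,
    ⟨parityMixture, inferInstance, parityMixture_translationInvariant,
      parityMixture_uniformlyInsertionTolerant, parityMixture_not_uniformlyUpwardsExtractable⟩,
    ⟨neighbourMaxLaw, inferInstance, neighbourMaxLaw_translationInvariant,
      neighbourMaxLaw_rigid.dominatesProduct, neighbourMaxLaw_not_uniformlyInsertionTolerant⟩,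
    ⟨neighbourMaxLaw, inferInstance, neighbourMaxLaw_translationInvariant, neighbourMaxLaw_rigid,
      fun h => neighbourMaxLaw_not_uniformlyInsertionTolerant h.uniformlyInsertionTolerant⟩,
    ⟨blockMixture half, inferInstance, blockMixture_translationInvariant half,
      blockMixture_dominatesProduct half_pos, blockMixture_not_rigid half_pos half_lt_one⟩,
    ⟨neighbourMaxLaw, inferInstance, neighbourMaxLaw_translationInvariant, neighbourMaxLaw_rigid,
      neighbourMaxLaw_not_uniformlyInsertionTolerant⟩⟩
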